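/- **The calculus $\lambda^*_\varepsilon$.** Fix base types $B$ with constants $c\in B$, among them $\mathsf{unit}\in\mathsf{Unit}$ and the allocation capability $\omega\in\mathsf{Alloc}$. Qualifiers, effects and observations $p,q,r,\varepsilon,\varphi$ are finite sets of variables and store locations. Values, terms and types are $$v::=c\mid\lambda x.t\mid\ell,\qquad t::=v\mid x\mid t\,t\mid\mathbf{ref}_t\,t\mid{!t}\mid t:=t\mid\mathbf{let}\;x=t\;\mathbf{in}\;t,\qquad T::=B\mid\mathsf{Ref}\,B\mid(x:T^{p})\to^{\varepsilon}U^{r},$$ where in the function type $x$ is bound in $\varepsilon,U,r$. A typing environment $\Gamma$ is a sequence of assumptions $x:T^q$, and a store typing $\Sigma$ is a finite map from locations to qualified types $T^q$ that mention only locations bound in $\Sigma$. $\Sigma'\supseteq\Sigma$ is extension of maps. Relative to $\Gamma,\Sigma$, an atom (variable or location) bound with qualifier $q$ reaches every member of $q$, and $q^*$ is the set of atoms reachable from $q$ in zero or more steps. $q[p/x]$ is $(q\setminus\{x\})\cup p$ if $x\in q$, and $q$ otherwise. *Subtyping.* $\Gamma\mid\Sigma\vdash p<:q$ iff $p\subseteq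 q\subseteq\mathrm{dom}(\Gamma)\cup\mathrm{dom}(\Sigma)$. $\Gamma\mid\Sigma\vdash S^p\,\varepsilon_1<:T^q\,\varepsilon_2$ iff $S<:T$, $p<:q$ and $\varepsilon_1<:\varepsilon_2$. Base and reference types are subtypes only of themselves; $(x:S^o)\to^{\varepsilon_1}T^q<:(x:U^p)\to^{\varepsilon_2}V^r$ if $\Gamma\mid\Sigma\vdash U^p\,\varnothing<:S^o\,\varnothing$ and $\Gamma,x:U^p\mid\Sigma\vdash T^q\,\varepsilon_1<:V^r\,\varepsilon_2$. *Typing* $[\Gamma\mid\Sigma]^\varphi\vdash t:T^q\;\varepsilon$ is generated by the following rules (context $[\Gamma\mid\Sigma]^\varphi$ unless shown). - $c:B^\varnothing\,\varnothing$ if $c\in B$; $x:T^{x}\,\varnothing$ if $x:T^q\in\Gamma$ and $x\in\varphi$; $\ell:T^{\ell}\,\varnothing$ if $\ell:T^q\in\Sigma$ and $\ell\in\varphi$. - $\lambda x.t:((x:T^p)\to^\varepsilon U^r)^q\,\varnothing$ if $[\Gamma,x:T^p\mid\Sigma]^{q,x}\vdash t:U^r\,\varepsilon$, $q\subseteq\varphi$,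 and $T^p$ mentions only variables and locations bound in $\Gamma,\Sigma$. - $t_1\,t_2:(U^{r}\;\varepsilon_1\cup\varepsilon_2\cup\varepsilon_3)[p/x]$ if $t_1:((x:T^{p^*\cap q^*})\to^{\varepsilon_3}U^r)^q\,\varepsilon_1$, $t_2:T^p\,\varepsilon_2$, $p^*\subseteq\varphi$, $q^*\subseteq\varphi$, $x\notin\mathrm{fv}(U)$, $\varepsilon_3\subseteq q,x$ and $r\subseteq\varphi,x$. - $\mathbf{let}\;x=t_1\;\mathbf{in}\;t_2:(T^q\;\varepsilon_1\cup\varepsilon_2)[p/x]$ if $t_1:S^p\,\varepsilon_1$, $[\Gamma,x:S^{p^*\cap\varphi^*}\mid\Sigma]^{\varphi,x}\vdash t_2:T^q\,\varepsilon_2$ and $x\notin\mathrm{fv}(T)$. - $\mathbf{ref}_{t_1}\,t_2:(\mathsf{Ref}\,B)^\varnothing\;\varepsilon_1\cup\varepsilon_2\cup q$ if $t_1:\mathsf{Alloc}^q\,\varepsilon_1$ and $t_2:B^\varnothing\,\varepsilon_2$; $\;!t:B^\varnothing\;\varepsilon\cup q$ if $t:(\mathsf{Ref}\,B)^q\,\varepsilon$;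 $\;t_1:=t_2:\mathsf{Unit}^\varnothing\;\varepsilon_1\cup\varepsilon_2\cup q$ if $t_1:(\mathsf{Ref}\,B)^q\,\varepsilon_1$ and $t_2:B^\varnothing\,\varepsilon_2$. - $t:T^q\,\varepsilon_2$ if $t:S^p\,\varepsilon_1$, $\Gamma\mid\Sigma\vdash S^p\,\varepsilon_1<:T^q\,\varepsilon_2$ and $q,\varepsilon_2\subseteq\varphi$. *Stores and reduction.* A store $\sigma$ is a sequence of bindings $\ell=\omega$ or $\ell=\mathbf{ref}_\omega\,v$. Well-formedness $[\Gamma\mid\Sigma]^\varphi\vdash\sigma$ holds for the empty store with empty $\Sigma$, for a single binding $w=\omega$ with $\Sigma=\{w:\mathsf{Alloc}^\varnothing\}$, and is preserved by appending $\ell=\mathbf{ref}_\omega\,v$ and adding $\ell:(\mathsf{Ref}\,B)^\varnothing$ to $\Sigma$, when $\ell\notin\mathrm{dom}(\Sigma)$ and $[\Gamma\mid\Sigma]^\varphi\vdash v:B^\varnothing\,\varnothing$. Evaluation contexts are $E::=\square\mid E\,t\mid v\,E\mid\mathbf{ref}_E\,t\mid\mathbf{ref}_v\,E\mid{!E}\mid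 E:=t\mid v:=E\mid\mathbf{let}\;x=E\;\mathbf{in}\;t$. The one-step relation $\sigma\mid t\longrightarrow\sigma'\mid t'$ is given by $$\sigma\mid E[(\lambda x.t)\,v]\longrightarrow\sigma\mid E[t[v/x]],\qquad \sigma\mid E[\mathbf{let}\;x=v\;\mathbf{in}\;t]\longrightarrow\sigma\mid E[t[v/x]],$$ $$\sigma\mid E[\mathbf{ref}_a\,v]\longrightarrow\sigma,\ell=\mathbf{ref}_\omega\,v\mid E[\ell]\quad(\ell\notin\mathrm{dom}(\sigma),\ a=\omega\text{ or }a\text{ a location bound to }\omega\text{ in }\sigma),$$ $$\sigma\mid E[!\ell]\longrightarrow\sigma\mid E[v]\quad(\ell=\mathbf{ref}_\omega\,v\text{ in }\sigma),$$ $$\sigma_1,\ell=\mathbf{ref}_\omega\,v,\sigma_2\mid E[\ell:=v']\longrightarrow\sigma_1,\ell=\mathbf{ref}_\omega\,v',\sigma_2\mid E[\mathsf{unit}].$$ **Corollary (Preservation of Separation).** Suppose $$[\varnothing\mid\Sigma]^{\mathrm{dom}(\Sigma)}\vdash t_1:T_1^{q_1}\;\varepsilon_1,\qquad [\varnothing\mid\Sigma]^{\mathrm{dom}(\Sigma)}\vdash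 t_2:T_2^{q_2}\;\varepsilon_2,\qquad [\varnothing\mid\Sigma]^{\mathrm{dom}(\Sigma)}\vdash\sigma,$$ $$\sigma\mid t_1\longrightarrow\sigma'\mid t_1',\qquad \sigma'\mid t_2\longrightarrow\sigma''\mid t_2',\qquad q_1\cap q_2=\varnothing .$$ Then there exist qualifiers $p_1,p_2$, effects $\varepsilon_1',\varepsilon_2'$ and store typings $\Sigma''\supseteq\Sigma'\supseteq\Sigma$ such that $$[\varnothing\mid\Sigma']^{\mathrm{dom}(\Sigma')}\vdash t_1':T_1^{p_1}\;\varepsilon_1',\qquad [\varnothing\mid\Sigma'']^{\mathrm{dom}(\Sigma'')}\vdash t_2':T_2^{p_2}\;\varepsilon_2',\qquad p_1\cap p_2=\varnothing .$$ -/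

import Mathlib

namespace LambdaStar

/-- Base types and constants. `mem c B` is `c ∈ B`. Among the base types are `Unit` (inhabited by
the constant `unit`) and `Alloc` (inhabited by the allocation capability `omega`). -/
structure Sig where
  Base : Type
  Const : Type
  mem : Const → Base → Prop
  unitTy : Base
  allocTy : Base
  unit : Const
  omega : Const
  unit_mem : mem unit unitTy
  omega_mem : mem omega allocTy

/-- Store locations. -/
abbrev Loc := ℕ

/-- Variables (de Bruijn indices, left summand) and locations (right summand). -/
abbrev Atom := ℕ ⊕ Loc

/-- Qualifiers, effects and observations: finite sets of variables and locations. -/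
abbrev Qual := Finset Atom

/-- The atom of the variable with de Bruijn index `i`. -/
abbrev avar (i : ℕ) : Atom := Sum.inl i

/-- The atom of the location `l`. -/
abbrev aloc (l : Loc) : Atom := Sum.inr l

/-- Extend a renaming of variables under one binder. -/
def liftRen (ρ : ℕ → ℕ) : ℕ → ℕ
  | 0 => 0
  | i + 1 => ρ i + 1

/-! ### Qualifiers -/

namespace Qual

/-- Rename the variables of a qualifier. -/
def rename (ρ : ℕ → ℕ) (q : Qual) : Qual := q.image (Sum.map ρ id)

/-- Weaken a qualifier by one (innermost) variable. -/
def shift (q : Qual) : Qual := rename Nat.succ q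

/-- The qualifier `q, x`, where `q` lives outside the scope of the innermost variable `x`. -/
def withVar (q : Qual) : Qual := insert (avar 0) (shift q)

/-- The atoms that replace an atom under `[p/x]`, `x` the innermost variable. -/
def instAtom (p : Qual) : Atom → Qual
  | Sum.inl 0 => p
  | Sum.inl (i + 1) => {avar i}
  | Sum.inr l => {aloc l}

/-- Qualifier substitution `q[p/x]` for the innermost variable `x`, which is then out of scope. -/
def inst (p q : Qual) : Qual := q.biUnion (instAtom p)

end Qual

/-- `dom(Γ) ∪ dom(Σ)` for a context of length `n` and a store typing with domain `D`. -/
def domAtoms (n : ℕ) (D : Finset Loc) : Qual := (Finset.range n).image avar ∪ D.image aloc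

/-! ### Types -/

/-- Types. In `arr T p ε U r`, that is `(x : T^p) →^ε U^r`, the variable `x` is bound in `ε`, `U`
and `r`, where it has index `0`. -/
inductive Ty (S : Sig) : Type where
  | base (B : S.Base) : Ty S
  | ref (B : S.Base) : Ty S
  | arr (T : Ty S) (p : Qual) (ε : Qual) (U : Ty S) (r : Qual) : Ty S

namespace Ty

variable {S : Sig}

/-- Rename the free variables of a type. -/
def rename : (ℕ → ℕ) → Ty S → Ty S
  | _, base B => base B
  | _, ref B => ref B
  | ρ, arr T p ε U r =>
      arr (rename ρ T) (Qual.rename ρ p) (Qual.rename (liftRen ρ) ε)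
        (rename (liftRen ρ) U) (Qual.rename (liftRen ρ) r)

/-- Weaken a type by one (innermost) variable. The types in which the innermost variable does not
occur free are those of the form `shift U`. -/
def shift (T : Ty S) : Ty S := rename Nat.succ T

/-- All qualifiers and effects in a type mention only variables and locations in scope. -/
def Scoped : ℕ → Finset Loc → Ty S → Prop
  | _, _, base _ => True
  | _, _, ref _ => True
  | n, D, arr T p ε U r =>
      Scoped n D T ∧ p ⊆ domAtoms n D ∧ ε ⊆ domAtoms (n + 1) D ∧
        Scoped (n + 1) D U ∧ r ⊆ domAtoms (n + 1) D

end Ty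

/-! ### Terms -/

/-- Terms, with de Bruijn indices. `lam t` binds in `t`; `letin t₁ t₂` is `let x = t₁ in t₂` and
binds in `t₂`; `ref t₁ t₂` is the allocation of a cell holding `t₂` with the capability `t₁`. -/
inductive Tm (S : Sig) : Type where
  | cst (c : S.Const) : Tm S
  | loc (l : Loc) : Tm S
  | var (i : ℕ) : Tm S
  | lam (t : Tm S) : Tm S
  | app (t₁ t₂ : Tm S) : Tm S
  | ref (t₁ t₂ : Tm S) : Tm S
  | deref (t : Tm S) : Tm S
  | assign (t₁ t₂ : Tm S) : Tm S
  | letin (t₁ t₂ : Tm S) : Tm S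

namespace Tm

variable {S : Sig}

/-- Rename the free variables of a term. -/
def rename : (ℕ → ℕ) → Tm S → Tm S
  | _, cst c => cst c
  | _, loc l => loc l
  | ρ, var i => var (ρ i)
  | ρ, lam t => lam (rename (liftRen ρ) t)
  | ρ, app t₁ t₂ => app (rename ρ t₁) (rename ρ t₂)
  | ρ, ref t₁ t₂ => ref (rename ρ t₁) (rename ρ t₂)
  | ρ, deref t => deref (rename ρ t)
  | ρ, assign t₁ t₂ => assign (rename ρ t₁) (rename ρ t₂)
  | ρ, letin t₁ t₂ => letin (rename ρ t₁) (rename (liftRen ρ) t₂)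

/-- Extend a substitution under one binder. -/
def liftSub (s : ℕ → Tm S) : ℕ → Tm S
  | 0 => var 0
  | i + 1 => rename Nat.succ (s i)

/-- Simultaneous capture-avoiding substitution. -/
def subst : (ℕ → Tm S) → Tm S → Tm S
  | _, cst c => cst c
  | _, loc l => loc l
  | s, var i => s i
  | s, lam t => lam (subst (liftSub s) t)
  | s, app t₁ t₂ => app (subst s t₁) (subst s t₂)
  | s, ref t₁ t₂ => ref (subst s t₁) (subst s t₂)
  | s, deref t => deref (subst s t)
  | s, assign t₁ t₂ => assign (subst s t₁) (subst s t₂)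
  | s, letin t₁ t₂ => letin (subst s t₁) (subst (liftSub s) t₂)

/-- The substitution of `v` for the innermost variable. -/
def instSub (v : Tm S) : ℕ → Tm S
  | 0 => v
  | i + 1 => var i

/-- `t[v/x]` for the innermost variable `x` of `t`. -/
def inst (v t : Tm S) : Tm S := subst (instSub v) t

/-- Values: constants, abstractions and locations. -/
inductive IsValue : Tm S → Prop
  | cst (c : S.Const) : IsValue (cst c)
  | lam (t : Tm S) : IsValue (lam t)
  | loc (l : Loc) : IsValue (loc l)

end Tm

/-! ### Environments -/

/-- Typing environments, innermost variable first. Every entry lives in the scope of the entries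
after it. -/
abbrev Ctx (S : Sig) := List (Ty S × Qual)

/-- `InCtx Γ x T q` is `x : T^q ∈ Γ`, with `T` and `q` read in the scope of all of `Γ`. -/
inductive InCtx {S : Sig} : Ctx S → ℕ → Ty S → Qual → Prop
  | zero (Γ : Ctx S) (T : Ty S) (q : Qual) : InCtx ((T, q) :: Γ) 0 T.shift q.shift
  | succ {Γ : Ctx S} {i : ℕ} {T : Ty S} {q : Qual} (b : Ty S × Qual) (h : InCtx Γ i T q) :
      InCtx (b :: Γ) (i + 1) T.shift q.shift

/-- Store typings: finite maps from locations to qualified types. -/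
abbrev StoreTy (S : Sig) := Finmap (fun _ : Loc => Ty S × Qual)

namespace StoreTy

variable {S : Sig}

/-- `dom(Σ)` as a set of locations. -/
def dom (St : StoreTy S) : Finset Loc := St.keys

/-- `dom(Σ)` as an observation. -/
def obs (St : StoreTy S) : Qual := St.dom.image aloc

/-- `Σ' ⊇ Σ`. -/
def Extends (St' St : StoreTy S) : Prop :=
  ∀ (l : Loc) (b : Ty S × Qual), St.lookup l = some b → St'.lookup l = some b

/-- The qualified types in a store typing mention no variables, and only locations bound in it. -/
def WellScoped (St : StoreTy S) : Prop :=
  ∀ (l : Loc) (T : Ty S) (q : Qual), St.lookup l = some (T, q) →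
    T.Scoped 0 St.dom ∧ q ⊆ domAtoms 0 St.dom

end StoreTy

/-- `dom(Γ) ∪ dom(Σ)`. -/
def domOf {S : Sig} (Γ : Ctx S) (St : StoreTy S) : Qual := domAtoms Γ.length St.dom

/-! ### Reachability -/

/-- One-step reachability: an atom reaches the members of the qualifier that it is bound with. -/
inductive Reach {S : Sig} (Γ : Ctx S) (St : StoreTy S) : Atom → Atom → Prop
  | var {i : ℕ} {T : Ty S} {q : Qual} {b : Atom} (h : InCtx Γ i T q) (hb : b ∈ q) :
      Reach Γ St (avar i) b
  | loc {l : Loc} {T : Ty S} {q : Qual} {b : Atom} (h : St.lookup l = some (T, q)) (hb : b ∈ q) :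
      Reach Γ St (aloc l) b

/-- Saturation `q*`: everything reachable from `q` in zero or more steps. -/
def sat {S : Sig} (Γ : Ctx S) (St : StoreTy S) (q : Qual) : Set Atom :=
  {b | ∃ a ∈ q, Relation.ReflTransGen (Reach Γ St) a b}

/-! ### Subtyping -/

/-- Qualifier (and effect) subtyping `Γ | Σ ⊢ p <: q`. -/
def QSub {S : Sig} (Γ : Ctx S) (St : StoreTy S) (p q : Qual) : Prop :=
  p ⊆ q ∧ q ⊆ domOf Γ St

/-- Subtyping `Γ | Σ ⊢ T <: T'` of ordinary types. The subtyping of qualified types is unfolded in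
the rule for functions, see `SubQ`. -/
inductive Sub {S : Sig} : Ctx S → StoreTy S → Ty S → Ty S → Prop
  | base (Γ : Ctx S) (St : StoreTy S) (B : S.Base) : Sub Γ St (.base B) (.base B)
  | ref (Γ : Ctx S) (St : StoreTy S) (B : S.Base) : Sub Γ St (.ref B) (.ref B)
  | arr {Γ : Ctx S} {St : StoreTy S} {T U V W : Ty S} {o p q r ε₁ ε₂ : Qual}
      (hdom : Sub Γ St U V) (hdomq : QSub Γ St p o)
      (hcod : Sub ((U, p) :: Γ) St T W) (hcodq : QSub ((U, p) :: Γ) St q r)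
      (heff : QSub ((U, p) :: Γ) St ε₁ ε₂) :
      Sub Γ St (.arr V o ε₁ T q) (.arr U p ε₂ W r)

/-- Subtyping `Γ | Σ ⊢ T₁^p ε₁ <: T₂^q ε₂` of qualified types with effects. -/
def SubQ {S : Sig} (Γ : Ctx S) (St : StoreTy S) (T₁ : Ty S) (p ε₁ : Qual)
    (T₂ : Ty S) (q ε₂ : Qual) : Prop :=
  Sub Γ St T₁ T₂ ∧ QSub Γ St p q ∧ QSub Γ St ε₁ ε₂

/-! ### Term typing -/

/-- `HasType Γ St φ t T q ε` is the judgment `[Γ | Σ]^φ ⊢ t : T^q ε`. In `app` and `letin` the type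
of the result is `shift U`, which expresses that the bound variable is not free in it; hence the
substitution `[p/x]` acts only on the qualifier and the effect. Sequential composition of effects is
their union. In `abs` the assumption `T^p` on the parameter is well-scoped. In `app` the function
and the argument reach only what is observable. -/
inductive HasType {S : Sig} : Ctx S → StoreTy S → Qual → Tm S → Ty S → Qual → Qual → Prop
  | cst {Γ : Ctx S} {St : StoreTy S} {φ : Qual} {c : S.Const} {B : S.Base}
      (hc : S.mem c B) :
      HasType Γ St φ (.cst c) (.base B) ∅ ∅
  | var {Γ : Ctx S} {St : StoreTy S} {φ : Qual} {i : ℕ} {T : Ty S} {q : Qual}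
      (hx : InCtx Γ i T q) (hφ : avar i ∈ φ) :
      HasType Γ St φ (.var i) T {avar i} ∅
  | loc {Γ : Ctx S} {St : StoreTy S} {φ : Qual} {l : Loc} {T : Ty S} {q : Qual}
      (hl : St.lookup l = some (T, q)) (hφ : aloc l ∈ φ) :
      HasType Γ St φ (.loc l) T {aloc l} ∅
  | abs {Γ : Ctx S} {St : StoreTy S} {φ : Qual} {t : Tm S} {T U : Ty S} {p q r ε : Qual}
      (hT : T.Scoped Γ.length St.dom) (hp : p ⊆ domOf Γ St)
      (ht : HasType ((T, p) :: Γ) St q.withVar t U r ε) (hq : q ⊆ φ) :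
      HasType Γ St φ (.lam t) (.arr T p ε U r) q ∅
  | app {Γ : Ctx S} {St : StoreTy S} {φ : Qual} {t₁ t₂ : Tm S} {T U : Ty S}
      {p q r d ε₁ ε₂ ε₃ : Qual}
      (ht₁ : HasType Γ St φ t₁ (.arr T d ε₃ U.shift r) q ε₁)
      (ht₂ : HasType Γ St φ t₂ T p ε₂)
      (hd : (d : Set Atom) = sat Γ St p ∩ sat Γ St q)
      (hp : sat Γ St p ⊆ (φ : Set Atom)) (hq : sat Γ St q ⊆ (φ : Set Atom))
      (hε : ε₃ ⊆ q.withVar) (hr : r ⊆ φ.withVar) :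
      HasType Γ St φ (.app t₁ t₂) U (Qual.inst p r) (ε₁ ∪ ε₂ ∪ Qual.inst p ε₃)
  | letin {Γ : Ctx S} {St : StoreTy S} {φ : Qual} {t₁ t₂ : Tm S} {T U : Ty S}
      {p q d ε₁ ε₂ : Qual}
      (ht₁ : HasType Γ St φ t₁ T p ε₁)
      (hd : (d : Set Atom) = sat Γ St p ∩ sat Γ St φ)
      (ht₂ : HasType ((T, d) :: Γ) St φ.withVar t₂ U.shift q ε₂) :
      HasType Γ St φ (.letin t₁ t₂) U (Qual.inst p q) (ε₁ ∪ Qual.inst p ε₂)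
  | ref {Γ : Ctx S} {St : StoreTy S} {φ : Qual} {t₁ t₂ : Tm S} {B : S.Base} {q ε₁ ε₂ : Qual}
      (ht₁ : HasType Γ St φ t₁ (.base S.allocTy) q ε₁)
      (ht₂ : HasType Γ St φ t₂ (.base B) ∅ ε₂) :
      HasType Γ St φ (.ref t₁ t₂) (.ref B) ∅ (ε₁ ∪ ε₂ ∪ q)
  | deref {Γ : Ctx S} {St : StoreTy S} {φ : Qual} {t : Tm S} {B : S.Base} {q ε : Qual}
      (ht : HasType Γ St φ t (.ref B) q ε) :
      HasType Γ St φ (.deref t) (.base B) ∅ (ε ∪ q)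
  | assign {Γ : Ctx S} {St : StoreTy S} {φ : Qual} {t₁ t₂ : Tm S} {B : S.Base} {q ε₁ ε₂ : Qual}
      (ht₁ : HasType Γ St φ t₁ (.ref B) q ε₁)
      (ht₂ : HasType Γ St φ t₂ (.base B) ∅ ε₂) :
      HasType Γ St φ (.assign t₁ t₂) (.base S.unitTy) ∅ (ε₁ ∪ ε₂ ∪ q)
  | sub {Γ : Ctx S} {St : StoreTy S} {φ : Qual} {t : Tm S} {T U : Ty S} {p q ε₁ ε₂ : Qual}
      (ht : HasType Γ St φ t T p ε₁)
      (hs : SubQ Γ St T p ε₁ U q ε₂) (hq : q ⊆ φ) (hε : ε₂ ⊆ φ) :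
      HasType Γ St φ t U q ε₂

/-! ### Stores and reduction -/

/-- What a store binds to a location: the allocation capability `ω`, or a cell `ref_ω v`. -/
inductive Entry (S : Sig) : Type where
  | cap : Entry S
  | cell (v : Tm S) : Entry S

/-- Stores: sequences of bindings `let ℓ = ω` and `let ℓ = ref_ω v`, oldest first. -/
abbrev Store (S : Sig) := List (Loc × Entry S)

/-- `dom(σ)`. -/
def Store.dom {S : Sig} (σ : Store S) : List Loc := σ.map Prod.fst

/-- Well-formed stores `[Γ | Σ]^φ ⊢ σ`. A store is built by allocations, from the empty store or
from an initial store, which binds one location `w : Alloc^∅` to the capability `ω`. -/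
inductive WfStore {S : Sig} (Γ : Ctx S) (φ : Qual) : StoreTy S → Store S → Prop
  | empty : WfStore Γ φ ∅ []
  | init (w : Loc) :
      WfStore Γ φ (Finmap.singleton w (Ty.base S.allocTy, ∅)) [(w, .cap)]
  | alloc {St : StoreTy S} {σ : Store S} {v : Tm S} {B : S.Base} {l : Loc}
      (hσ : WfStore Γ φ St σ) (hval : v.IsValue)
      (hv : HasType Γ St φ v (.base B) ∅ ∅) (hl : l ∉ St.dom) :
      WfStore Γ φ (St.insert l (Ty.ref B, ∅)) (σ ++ [(l, .cell v)])

/-- Call-by-value evaluation contexts. -/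
inductive ECtx (S : Sig) : Type where
  | hole : ECtx S
  | appL (E : ECtx S) (t : Tm S) : ECtx S
  | appR (v : Tm S) (hv : v.IsValue) (E : ECtx S) : ECtx S
  | refL (E : ECtx S) (t : Tm S) : ECtx S
  | refR (v : Tm S) (hv : v.IsValue) (E : ECtx S) : ECtx S
  | deref (E : ECtx S) : ECtx S
  | assignL (E : ECtx S) (t : Tm S) : ECtx S
  | assignR (v : Tm S) (hv : v.IsValue) (E : ECtx S) : ECtx S
  | letin (E : ECtx S) (t : Tm S) : ECtx S

/-- `E[t]`. -/
def ECtx.plug {S : Sig} : ECtx S → Tm S → Tm S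
  | .hole, u => u
  | .appL E t, u => .app (E.plug u) t
  | .appR v _ E, u => .app v (E.plug u)
  | .refL E t, u => .ref (E.plug u) t
  | .refR v _ E, u => .ref v (E.plug u)
  | .deref E, u => .deref (E.plug u)
  | .assignL E t, u => .assign (E.plug u) t
  | .assignR v _ E, u => .assign v (E.plug u)
  | .letin E t, u => .letin (E.plug u) t

/-- The values that act as the allocation capability in a store: the constant `ω`, and every
location that the store binds to `ω`. -/
inductive IsCap {S : Sig} (σ : Store S) : Tm S → Prop
  | omega : IsCap σ (.cst S.omega)
  | loc {w : Loc} (h : (w, Entry.cap) ∈ σ) : IsCap σ (.loc w)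

/-- Single-step call-by-value reduction: `Step σ t σ' t'` is `σ | t ⟶ σ' | t'`. -/
inductive Step {S : Sig} : Store S → Tm S → Store S → Tm S → Prop
  | beta (σ : Store S) (E : ECtx S) (t v : Tm S) (hv : v.IsValue) :
      Step σ (E.plug (.app (.lam t) v)) σ (E.plug (Tm.inst v t))
  | letin (σ : Store S) (E : ECtx S) (v t : Tm S) (hv : v.IsValue) :
      Step σ (E.plug (.letin v t)) σ (E.plug (Tm.inst v t))
  | ref (σ : Store S) (E : ECtx S) (a v : Tm S) (l : Loc) (ha : IsCap σ a) (hv : v.IsValue)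
      (hl : l ∉ σ.dom) :
      Step σ (E.plug (.ref a v)) (σ ++ [(l, .cell v)]) (E.plug (.loc l))
  | deref (σ₁ σ₂ : Store S) (E : ECtx S) (l : Loc) (v : Tm S) :
      Step (σ₁ ++ (l, .cell v) :: σ₂) (E.plug (.deref (.loc l)))
        (σ₁ ++ (l, .cell v) :: σ₂) (E.plug v)
  | assign (σ₁ σ₂ : Store S) (E : ECtx S) (l : Loc) (v v' : Tm S) (hv' : v'.IsValue) :
      Step (σ₁ ++ (l, .cell v) :: σ₂) (E.plug (.assign (.loc l) v'))
        (σ₁ ++ (l, .cell v') :: σ₂) (E.plug (.cst S.unit))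

end LambdaStar

/-!
Before it runs, the program can mention only the locations in `dom(Σ)`, and every new location that
its qualifier acquires in a step is freshly allocated. So preservation is proved in a sharper form:
a step turns `T^q ε` into `T^(q ∪ F) (ε ∪ F)`, where `F` is disjoint from `dom(Σ)` and contains only
locations of reference type. Separation follows, since the `F` of the first step is disjoint from
`q₂ ⊆ dom(Σ)` and the `F` of the second step from `p₁ ⊆ dom(Σ')`.

Two points need care. The application rule compares saturations, and the saturation of a substituted
qualifier is computed correctly only if the substitution creates no new overlap. For closed terms
this is harmless because a first-order store is flat: its locations reach nothing but themselves.
Moreover `ref` and `:=` demand the qualifier `∅` for the stored term, which may have grown by `F`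
while being evaluated. However, a term of base type never needs locations of reference type in its
qualifier, so `F` can be removed again.
-/

namespace LambdaStar

/-! ### Simultaneous substitution of qualifiers for variables -/

/-- A simultaneous substitution: the qualifier that replaces each variable. Renamings, the
instantiation `[p/x]` of a bound variable and the growth of a qualifier are all of this form, so
the calculus of typings is developed for these substitutions. -/
abbrev QSubst := ℕ → Qual

namespace QSubst

/-- The substitution carried under one binder. -/
def lift (θ : QSubst) : QSubst
  | 0 => {avar 0}
  | i + 1 => Qual.shift (θ i)

/-- The substitution `[p/x]` for the innermost variable `x`, which is then out of scope. -/
def single (p : Qual) : QSubst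
  | 0 => p
  | i + 1 => {avar i}

/-- A renaming of variables, as a substitution. -/
def ofRen (ρ : ℕ → ℕ) : QSubst := fun i => {avar (ρ i)}

end QSubst

/-- Weakening of an atom by one (innermost) variable. -/
def shiftAtom : Atom → Atom := Sum.map Nat.succ id

namespace Qual

/-- The image of an atom under a substitution; locations are fixed. -/
def substAtom (θ : QSubst) : Atom → Qual
  | Sum.inl i => θ i
  | Sum.inr l => {aloc l}

/-- The image of a qualifier under a substitution. -/
def subst (θ : QSubst) (q : Qual) : Qual := q.biUnion (substAtom θ)

@[simp] theorem substAtom_inl (θ : QSubst) (i : ℕ) : substAtom θ (Sum.inl i) = θ i := rfl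

@[simp] theorem substAtom_inr (θ : QSubst) (l : Loc) : substAtom θ (Sum.inr l) = {aloc l} := rfl

theorem mem_subst {θ : QSubst} {q : Qual} {a : Atom} :
    a ∈ subst θ q ↔ ∃ b ∈ q, a ∈ substAtom θ b := by
  simp [subst]

theorem mem_shift {q : Qual} {a : Atom} : a ∈ shift q ↔ ∃ b ∈ q, shiftAtom b = a := by
  simp only [shift, rename, shiftAtom, Finset.mem_image]

theorem shiftAtom_injective : Function.Injective shiftAtom :=
  Sum.map_injective.2 ⟨Nat.succ_injective, Function.injective_id⟩

@[simp] theorem shiftAtom_inj {a b : Atom} : shiftAtom a = shiftAtom b ↔ a = b :=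
  shiftAtom_injective.eq_iff

@[simp] theorem shiftAtom_mem_shift {q : Qual} {a : Atom} : shiftAtom a ∈ shift q ↔ a ∈ q := by
  simp [mem_shift]

theorem shiftAtom_ne_zero (a : Atom) : shiftAtom a ≠ avar 0 := by
  rcases a with i | l <;> simp [shiftAtom]

@[simp] theorem zero_notMem_shift {q : Qual} : avar 0 ∉ shift q := by
  simp only [mem_shift, not_exists, not_and]
  exact fun a _ => shiftAtom_ne_zero a

theorem atom_cases (a : Atom) : a = avar 0 ∨ ∃ b, a = shiftAtom b := by
  rcases a with (_ | i) | l
  · exact .inl rfl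
  · exact .inr ⟨Sum.inl i, rfl⟩
  · exact .inr ⟨Sum.inr l, rfl⟩

theorem mem_withVar {q : Qual} {a : Atom} :
    a ∈ withVar q ↔ a = avar 0 ∨ ∃ b ∈ q, shiftAtom b = a := by
  simp [withVar, mem_shift]

@[simp] theorem shiftAtom_mem_withVar {q : Qual} {a : Atom} :
    shiftAtom a ∈ withVar q ↔ a ∈ q := by
  simp [mem_withVar, shiftAtom_ne_zero]

@[simp] theorem zero_mem_withVar {q : Qual} : avar 0 ∈ withVar q := by simp [mem_withVar]

theorem withVar_mono {p q : Qual} (h : p ⊆ q) : withVar p ⊆ withVar q := by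
  intro a ha
  rw [mem_withVar] at ha ⊢
  exact ha.imp_right fun ⟨b, hb, e⟩ => ⟨b, h hb, e⟩

theorem shift_mono {p q : Qual} (h : p ⊆ q) : shift p ⊆ shift q := Finset.image_subset_image h

theorem subst_mono (θ : QSubst) {p q : Qual} (h : p ⊆ q) : subst θ p ⊆ subst θ q :=
  Finset.biUnion_subset_biUnion_of_subset_left _ h

theorem subst_union (θ : QSubst) (p q : Qual) : subst θ (p ∪ q) = subst θ p ∪ subst θ q :=
  Finset.union_biUnion ..

@[simp] theorem subst_singleton (θ : QSubst) (a : Atom) : subst θ {a} = substAtom θ a :=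
  Finset.singleton_biUnion ..

theorem substAtom_subset_subst {θ : QSubst} {q : Qual} {a : Atom} (h : a ∈ q) :
    substAtom θ a ⊆ subst θ q := Finset.subset_biUnion_of_mem _ h

theorem subst_congr {θ τ : QSubst} (h : ∀ i, θ i = τ i) (q : Qual) : subst θ q = subst τ q := by
  rw [funext h]

theorem rename_eq_subst (ρ : ℕ → ℕ) (q : Qual) : rename ρ q = subst (QSubst.ofRen ρ) q := by
  ext a
  simp only [rename, Finset.mem_image, mem_subst]
  refine exists_congr fun b => and_congr_right fun _ => ?_
  rcases b with i | l <;> simp [QSubst.ofRen, eq_comm]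

theorem shift_eq_subst (q : Qual) : shift q = subst (QSubst.ofRen Nat.succ) q :=
  rename_eq_subst _ _

theorem inst_eq_subst (p q : Qual) : inst p q = subst (QSubst.single p) q := by
  unfold inst subst
  congr 1
  funext a
  rcases a with (_ | i) | l <;> rfl

theorem subst_subst (τ θ : QSubst) (q : Qual) :
    subst τ (subst θ q) = subst (fun i => subst τ (θ i)) q := by
  unfold subst
  rw [Finset.biUnion_biUnion]
  congr 1
  funext a
  rcases a with i | l
  · rfl
  · simp

theorem subst_ofRen_id (q : Qual) : subst (QSubst.ofRen id) q = q := by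
  rw [← rename_eq_subst]
  simp [rename]

theorem substAtom_lift_shiftAtom (θ : QSubst) (a : Atom) :
    substAtom θ.lift (shiftAtom a) = shift (substAtom θ a) := by
  rcases a with i | l
  · rfl
  · ext b
    simp [mem_shift, shiftAtom, eq_comm]

theorem zero_mem_substAtom_lift {θ : QSubst} {a : Atom} :
    avar 0 ∈ substAtom θ.lift a ↔ a = avar 0 := by
  rcases atom_cases a with rfl | ⟨b, rfl⟩
  · simp [QSubst.lift]
  · simp [substAtom_lift_shiftAtom, shiftAtom_ne_zero]

theorem shiftAtom_mem_substAtom_lift {θ : QSubst} {a c : Atom} :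
    shiftAtom c ∈ substAtom θ.lift a ↔ ∃ b, a = shiftAtom b ∧ c ∈ substAtom θ b := by
  rcases atom_cases a with rfl | ⟨b, rfl⟩
  · simp [QSubst.lift, shiftAtom_ne_zero, (shiftAtom_ne_zero _).symm]
  · simp [substAtom_lift_shiftAtom]

theorem subst_lift_shift (θ : QSubst) (q : Qual) :
    subst θ.lift (shift q) = shift (subst θ q) := by
  rw [shift_eq_subst, shift_eq_subst, subst_subst, subst_subst]
  refine subst_congr (fun i => ?_) _
  simp [QSubst.ofRen, QSubst.lift, shift_eq_subst]

theorem subst_lift_withVar (θ : QSubst) (q : Qual) :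
    subst θ.lift (withVar q) = withVar (subst θ q) := by
  rw [withVar, Finset.insert_eq, subst_union, subst_lift_shift]
  rfl

theorem subst_inst (θ : QSubst) (p q : Qual) :
    subst θ (inst p q) = inst (subst θ p) (subst θ.lift q) := by
  rw [inst_eq_subst, inst_eq_subst, subst_subst, subst_subst]
  refine subst_congr (fun i => ?_) _
  cases i with
  | zero => simp [QSubst.single, QSubst.lift]
  | succ i =>
    simp only [QSubst.single, QSubst.lift, shift_eq_subst, subst_subst, subst_singleton,
      substAtom_inl]
    conv_lhs => rw [← subst_ofRen_id (θ i)]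
    refine subst_congr (fun j => ?_) _
    simp [QSubst.ofRen, QSubst.single]

theorem inst_mono {p p' q q' : Qual} (hp : p ⊆ p') (hq : q ⊆ q') : inst p q ⊆ inst p' q' := by
  refine Finset.biUnion_subset_biUnion_of_subset_left _ hq |>.trans ?_
  refine Finset.biUnion_mono fun a _ => ?_
  rcases a with (_ | i) | l
  · exact hp
  · exact subset_rfl
  · exact subset_rfl

theorem mem_inst {p q : Qual} {a : Atom} :
    a ∈ inst p q ↔ (a ∈ p ∧ avar 0 ∈ q) ∨ shiftAtom a ∈ q := by
  simp only [inst, Finset.mem_biUnion]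
  constructor
  · rintro ⟨(_ | i) | l, hb, h⟩
    · exact .inl ⟨h, hb⟩
    · exact .inr (Finset.mem_singleton.1 h ▸ hb)
    · exact .inr (Finset.mem_singleton.1 h ▸ hb)
  · rintro (⟨h, hb⟩ | h)
    · exact ⟨_, hb, h⟩
    · refine ⟨_, h, ?_⟩
      rcases a with i | l <;> simp [instAtom, shiftAtom]

theorem inst_subset {p q φ : Qual} (hp : p ⊆ φ) (hq : q ⊆ withVar φ) : inst p q ⊆ φ := by
  intro a ha
  rcases mem_inst.1 ha with h | h
  · exact hp h.1
  · exact shiftAtom_mem_withVar.1 (hq h)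

end Qual

namespace QSubst

theorem lift_ofRen (ρ : ℕ → ℕ) : lift (ofRen ρ) = ofRen (liftRen ρ) := by
  funext i
  cases i with
  | zero => rfl
  | succ i => simp [lift, ofRen, liftRen, Qual.shift, Qual.rename]

theorem lift_comp (τ θ : QSubst) :
    (fun i => Qual.subst τ.lift (θ.lift i)) = lift fun i => Qual.subst τ (θ i) := by
  funext i
  cases i with
  | zero => rfl
  | succ i => exact Qual.subst_lift_shift τ (θ i)

end QSubst

namespace Ty

variable {S : Sig}

/-- The image of a type under a substitution. -/
def subst : QSubst → Ty S → Ty S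
  | _, base B => base B
  | _, ref B => ref B
  | θ, arr T p ε U r =>
      arr (subst θ T) (Qual.subst θ p) (Qual.subst θ.lift ε)
        (subst θ.lift U) (Qual.subst θ.lift r)

theorem rename_eq_subst (ρ : ℕ → ℕ) (T : Ty S) : rename ρ T = subst (QSubst.ofRen ρ) T := by
  induction T generalizing ρ with
  | base B => rfl
  | ref B => rfl
  | arr T p ε U r ihT ihU =>
    simp only [rename, subst, ihT, ihU, Qual.rename_eq_subst, QSubst.lift_ofRen]

theorem shift_eq_subst (T : Ty S) : shift T = subst (QSubst.ofRen Nat.succ) T :=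
  rename_eq_subst _ _

theorem subst_subst (τ θ : QSubst) (T : Ty S) :
    subst τ (subst θ T) = subst (fun i => Qual.subst τ (θ i)) T := by
  induction T generalizing τ θ with
  | base B => rfl
  | ref B => rfl
  | arr T p ε U r ihT ihU => simp only [subst, ihT, ihU, Qual.subst_subst, QSubst.lift_comp]

theorem subst_ofRen_id (T : Ty S) : subst (QSubst.ofRen id) T = T := by
  induction T with
  | base B => rfl
  | ref B => rfl
  | arr T p ε U r ihT ihU =>
    have h : liftRen id = id := by funext i; cases i <;> rfl
    simp only [subst, QSubst.lift_ofRen, h, ihT, ihU, Qual.subst_ofRen_id]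

theorem subst_shift (θ : QSubst) (T : Ty S) :
    subst θ (shift T) = subst (fun i => θ (i + 1)) T := by
  rw [shift_eq_subst, subst_subst]
  congr 1
  funext i
  simp [QSubst.ofRen]

theorem subst_lift_shift (θ : QSubst) (T : Ty S) :
    subst θ.lift (shift T) = shift (subst θ T) := by
  rw [subst_shift, shift_eq_subst, subst_subst]
  congr 1
  funext i
  exact Qual.shift_eq_subst _

theorem subst_single_shift (p : Qual) (T : Ty S) : subst (QSubst.single p) (shift T) = T := by
  rw [subst_shift]
  exact subst_ofRen_id T

end Ty

/-! ### Scoping -/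

theorem mem_domAtoms {n : ℕ} {D : Finset Loc} {a : Atom} :
    a ∈ domAtoms n D ↔ (∃ i < n, a = avar i) ∨ ∃ l ∈ D, a = aloc l := by
  simp [domAtoms, eq_comm]

@[simp] theorem avar_mem_domAtoms {n : ℕ} {D : Finset Loc} {i : ℕ} :
    avar i ∈ domAtoms n D ↔ i < n := by
  simp [mem_domAtoms]

@[simp] theorem aloc_mem_domAtoms {n : ℕ} {D : Finset Loc} {l : Loc} :
    aloc l ∈ domAtoms n D ↔ l ∈ D := by
  simp [mem_domAtoms]

@[simp] theorem shiftAtom_mem_domAtoms {n : ℕ} {D : Finset Loc} {a : Atom} :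
    shiftAtom a ∈ domAtoms (n + 1) D ↔ a ∈ domAtoms n D := by
  rcases a with i | l
  · exact avar_mem_domAtoms.trans (by simp)
  · exact aloc_mem_domAtoms.trans aloc_mem_domAtoms.symm

theorem shift_subset_domAtoms {n : ℕ} {D : Finset Loc} {q : Qual} (h : q ⊆ domAtoms n D) :
    Qual.shift q ⊆ domAtoms (n + 1) D := by
  intro a ha
  obtain ⟨b, hb, rfl⟩ := Qual.mem_shift.1 ha
  exact shiftAtom_mem_domAtoms.2 (h hb)

theorem withVar_domAtoms (n : ℕ) (D : Finset Loc) :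
    Qual.withVar (domAtoms n D) = domAtoms (n + 1) D := by
  ext a
  rcases Qual.atom_cases a with rfl | ⟨b, rfl⟩ <;> simp

theorem withVar_subset_domAtoms {n : ℕ} {D : Finset Loc} {q : Qual} (h : q ⊆ domAtoms n D) :
    Qual.withVar q ⊆ domAtoms (n + 1) D :=
  withVar_domAtoms n D ▸ Qual.withVar_mono h

/-- The substitution `θ` carries everything in scope of `n` variables and the locations `D` into
the scope of `m` variables and the locations `D'`. -/
structure QSubst.Scoped (θ : QSubst) (n : ℕ) (D : Finset Loc) (m : ℕ) (D' : Finset Loc) : Prop where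
  var : ∀ i < n, θ i ⊆ domAtoms m D'
  loc : D ⊆ D'

namespace QSubst.Scoped

variable {S : Sig} {θ : QSubst} {n m : ℕ} {D D' : Finset Loc}

theorem subst_subset (h : θ.Scoped n D m D') {q : Qual} (hq : q ⊆ domAtoms n D) :
    Qual.subst θ q ⊆ domAtoms m D' := by
  intro a ha
  obtain ⟨b, hb, hab⟩ := Qual.mem_subst.1 ha
  rcases b with i | l
  · exact h.var i (avar_mem_domAtoms.1 (hq hb)) hab
  · rw [Qual.substAtom_inr, Finset.mem_singleton] at hab
    subst hab
    exact aloc_mem_domAtoms.2 (h.loc (aloc_mem_domAtoms.1 (hq hb)))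

theorem lift (h : θ.Scoped n D m D') : θ.lift.Scoped (n + 1) D (m + 1) D' := by
  refine ⟨fun i hi => ?_, h.loc⟩
  cases i with
  | zero => simp [QSubst.lift]
  | succ i => exact shift_subset_domAtoms (h.var i (by omega))

theorem ty_subst {T : Ty S} (h : θ.Scoped n D m D') (hT : T.Scoped n D) :
    (T.subst θ).Scoped m D' := by
  induction T generalizing θ n m with
  | base B => trivial
  | ref B => trivial
  | arr T p ε U r ihT ihU =>
    obtain ⟨hT, hp, hε, hU, hr⟩ := hT
    exact ⟨ihT h hT, h.subst_subset hp, h.lift.subst_subset hε, ihU h.lift hU,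
      h.lift.subst_subset hr⟩

end QSubst.Scoped

theorem QSubst.scoped_ofRen {ρ : ℕ → ℕ} {n m : ℕ} {D D' : Finset Loc} (hρ : ∀ i < n, ρ i < m)
    (hD : D ⊆ D') : (ofRen ρ).Scoped n D m D' :=
  ⟨fun i hi => Finset.singleton_subset_iff.2 (avar_mem_domAtoms.2 (hρ i hi)), hD⟩

theorem QSubst.scoped_succ (n : ℕ) (D : Finset Loc) : (ofRen Nat.succ).Scoped n D (n + 1) D :=
  scoped_ofRen (fun _ => Nat.succ_lt_succ) subset_rfl

theorem domAtoms_mono {n m : ℕ} {D D' : Finset Loc} (hn : n ≤ m) (hD : D ⊆ D') :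
    domAtoms n D ⊆ domAtoms m D' := by
  simpa only [Qual.subst_ofRen_id] using
    (QSubst.scoped_ofRen (ρ := id) (fun _ hi => hi.trans_le hn) hD).subst_subset subset_rfl

namespace Ty.Scoped

variable {S : Sig} {T : Ty S} {n m : ℕ} {D D' : Finset Loc}

theorem mono (hT : T.Scoped n D) (hn : n ≤ m) (hD : D ⊆ D') : T.Scoped m D' := by
  simpa only [subst_ofRen_id] using
    (QSubst.scoped_ofRen (ρ := id) (fun _ hi => hi.trans_le hn) hD).ty_subst hT

theorem shift (h : T.Scoped n D) : T.shift.Scoped (n + 1) D := by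
  rw [shift_eq_subst]
  exact (QSubst.scoped_succ n D).ty_subst h

end Ty.Scoped

theorem subset_domAtoms_of_rename {ρ : ℕ → ℕ} {n m : ℕ} {D : Finset Loc}
    (h : ∀ i, ρ i < m → i < n) {q : Qual} (hq : Qual.rename ρ q ⊆ domAtoms m D) :
    q ⊆ domAtoms n D := by
  intro a ha
  have := hq (Finset.mem_image_of_mem (Sum.map ρ id) ha)
  rcases a with i | l
  · exact avar_mem_domAtoms.2 (h i (avar_mem_domAtoms.1 this))
  · exact aloc_mem_domAtoms.2 (aloc_mem_domAtoms.1 this)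

theorem Qual.subst_eq_self {θ : QSubst} {n : ℕ} {D : Finset Loc} (hθ : ∀ i < n, θ i = {avar i})
    {q : Qual} (hq : q ⊆ domAtoms n D) : subst θ q = q := by
  refine (Finset.biUnion_congr rfl fun a ha => ?_).trans Finset.biUnion_singleton_eq_self
  rcases a with i | l
  · exact hθ i (avar_mem_domAtoms.1 (hq ha))
  · rfl

namespace Ty.Scoped

variable {S : Sig} {T : Ty S} {n m : ℕ} {D : Finset Loc}

theorem subst_eq_self {θ : QSubst} (hT : T.Scoped n D) (hθ : ∀ i < n, θ i = {avar i}) :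
    T.subst θ = T := by
  induction T generalizing θ n with
  | base B => rfl
  | ref B => rfl
  | arr T p ε U r ihT ihU =>
    obtain ⟨hT, hp, hε, hU, hr⟩ := hT
    have hθ' : ∀ i < n + 1, θ.lift i = {avar i} := by
      intro i hi
      cases i with
      | zero => rfl
      | succ i => simp [QSubst.lift, hθ i (Nat.lt_of_succ_lt_succ hi), Qual.shift, Qual.rename]
    simp only [subst, ihT hT hθ, Qual.subst_eq_self hθ hp, Qual.subst_eq_self hθ' hε,
      ihU hU hθ', Qual.subst_eq_self hθ' hr]

theorem subst_closed (hT : T.Scoped 0 D) (θ : QSubst) : T.subst θ = T :=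
  hT.subst_eq_self fun _ hi => absurd hi (Nat.not_lt_zero _)

theorem of_rename {ρ : ℕ → ℕ} (h : ∀ i, ρ i < m → i < n)
    (hT : (T.rename ρ).Scoped m D) : T.Scoped n D := by
  induction T generalizing ρ n m with
  | base B => trivial
  | ref B => trivial
  | arr T p ε U r ihT ihU =>
    obtain ⟨hT, hp, hε, hU, hr⟩ := hT
    have h' : ∀ i, liftRen ρ i < m + 1 → i < n + 1 := by
      intro i hi
      cases i with
      | zero => omega
      | succ i => exact Nat.succ_lt_succ (h i (Nat.lt_of_succ_lt_succ hi))
    exact ⟨ihT h hT, subset_domAtoms_of_rename h hp, subset_domAtoms_of_rename h' hε,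
      ihU h' hU, subset_domAtoms_of_rename h' hr⟩

theorem of_shift (hT : T.shift.Scoped (n + 1) D) : T.Scoped n D :=
  hT.of_rename fun _ h => Nat.lt_of_succ_lt_succ h

end Ty.Scoped

variable {S : Sig}

/-! ### Regularity of typing -/

theorem StoreTy.mem_dom {St : StoreTy S} {l : Loc} : l ∈ St.dom ↔ ∃ b, St.lookup l = some b := by
  rw [StoreTy.dom, Finmap.mem_keys, ← Finmap.lookup_isSome, Option.isSome_iff_exists]

theorem StoreTy.obs_eq_domAtoms (St : StoreTy S) : St.obs = domAtoms 0 St.dom := by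
  simp [StoreTy.obs, domAtoms]

theorem InCtx.lt_length {Γ : Ctx S} {i : ℕ} {T : Ty S} {q : Qual} (h : InCtx Γ i T q) :
    i < Γ.length := by
  induction h with
  | zero => simp
  | succ _ _ ih => simpa using ih

/-- Every entry of the context is in scope. -/
def ScopedCtx (Γ : Ctx S) (St : StoreTy S) : Prop :=
  ∀ (i : ℕ) (T : Ty S) (q : Qual), InCtx Γ i T q → T.Scoped Γ.length St.dom ∧ q ⊆ domOf Γ St

theorem ScopedCtx.cons {Γ : Ctx S} {St : StoreTy S} {T : Ty S} {q : Qual} (h : ScopedCtx Γ St)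
    (hT : T.Scoped Γ.length St.dom) (hq : q ⊆ domOf Γ St) : ScopedCtx ((T, q) :: Γ) St := by
  intro i U r hi
  cases hi with
  | zero => exact ⟨hT.shift, shift_subset_domAtoms hq⟩
  | succ _ hi =>
    obtain ⟨hU, hr⟩ := h _ _ _ hi
    exact ⟨hU.shift, shift_subset_domAtoms hr⟩

/-- Well-formedness of the environment `[Γ | Σ]^φ` of a typing judgment: everything that is
mentioned in it is in scope. -/
structure WfEnv (Γ : Ctx S) (St : StoreTy S) (φ : Qual) : Prop where
  store : St.WellScoped
  ctx : ScopedCtx Γ St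
  obs : φ ⊆ domOf Γ St

theorem StoreTy.WellScoped.wfEnv {St : StoreTy S} (h : St.WellScoped) : WfEnv [] St St.obs :=
  ⟨h, (fun _ _ _ hi => nomatch hi), St.obs_eq_domAtoms.subset⟩

namespace WfEnv

variable {Γ : Ctx S} {St : StoreTy S} {φ ψ : Qual}

theorem mono (h : WfEnv Γ St φ) (hψ : ψ ⊆ φ) : WfEnv Γ St ψ := ⟨h.store, h.ctx, hψ.trans h.obs⟩

theorem cons (h : WfEnv Γ St φ) {T : Ty S} {p : Qual} (hT : T.Scoped Γ.length St.dom)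
    (hp : p ⊆ domOf Γ St) : WfEnv ((T, p) :: Γ) St φ.withVar :=
  ⟨h.store, h.ctx.cons hT hp, withVar_subset_domAtoms h.obs⟩

theorem mem_domOf_of_reach (h : WfEnv Γ St φ) {a b : Atom} (hab : Reach Γ St a b) :
    b ∈ domOf Γ St := by
  cases hab with
  | var hi hb => exact (h.ctx _ _ _ hi).2 hb
  | loc hl hb => exact domAtoms_mono (Nat.zero_le _) subset_rfl ((h.store _ _ _ hl).2 hb)

theorem sat_subset_domOf (h : WfEnv Γ St φ) {q : Qual} (hq : q ⊆ φ) :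
    sat Γ St q ⊆ (domOf Γ St : Set Atom) := by
  rintro a ⟨b, hb, hr⟩
  induction hr with
  | refl => exact h.obs (hq hb)
  | tail _ hab _ => exact h.mem_domOf_of_reach hab

end WfEnv

theorem subset_sat (Γ : Ctx S) (St : StoreTy S) (q : Qual) : (q : Set Atom) ⊆ sat Γ St q :=
  fun a ha => ⟨a, ha, .refl⟩

theorem sat_mono (Γ : Ctx S) (St : StoreTy S) {p q : Qual} (h : p ⊆ q) :
    sat Γ St p ⊆ sat Γ St q :=
  fun _ ⟨b, hb, hr⟩ => ⟨b, h hb, hr⟩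

namespace Sub

variable {Γ : Ctx S} {St : StoreTy S} {T U : Ty S}

theorem refl (h : T.Scoped Γ.length St.dom) : Sub Γ St T T := by
  induction T generalizing Γ with
  | base B => exact .base ..
  | ref B => exact .ref ..
  | arr T p ε U r ihT ihU =>
    obtain ⟨hT, hp, hε, hU, hr⟩ := h
    exact .arr (ihT hT) ⟨subset_rfl, hp⟩ (ihU hU) ⟨subset_rfl, hr⟩ ⟨subset_rfl, hε⟩

theorem scoped_iff (h : Sub Γ St T U) :
    T.Scoped Γ.length St.dom ↔ U.Scoped Γ.length St.dom := by
  induction h with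
  | base => rfl
  | ref => rfl
  | arr _ hp _ hq hε ihdom ihcod =>
    constructor
    · rintro ⟨hT, -, -, hU, -⟩
      exact ⟨ihdom.2 hT, hp.1.trans hp.2, hε.2, ihcod.1 hU, hq.2⟩
    · rintro ⟨hT, -, -, hU, -⟩
      exact ⟨ihdom.1 hT, hp.2, hε.1.trans hε.2, ihcod.2 hU, hq.1.trans hq.2⟩

end Sub

namespace HasType

variable {Γ : Ctx S} {St : StoreTy S} {φ : Qual} {t : Tm S} {T : Ty S} {q ε : Qual}

theorem subset_obs (h : HasType Γ St φ t T q ε) : q ⊆ φ ∧ ε ⊆ φ := by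
  induction h with
  | cst => exact ⟨Finset.empty_subset _, Finset.empty_subset _⟩
  | var _ h => exact ⟨Finset.singleton_subset_iff.2 h, Finset.empty_subset _⟩
  | loc _ h => exact ⟨Finset.singleton_subset_iff.2 h, Finset.empty_subset _⟩
  | abs _ _ _ hq => exact ⟨hq, Finset.empty_subset _⟩
  | app _ _ _ _ _ hε hr ih₁ ih₂ =>
    exact ⟨Qual.inst_subset ih₂.1 hr, Finset.union_subset (Finset.union_subset ih₁.2 ih₂.2)
      (Qual.inst_subset ih₂.1 (hε.trans (Qual.withVar_mono ih₁.1)))⟩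
  | letin _ _ _ ih₁ ih₂ =>
    exact ⟨Qual.inst_subset ih₁.1 ih₂.1,
      Finset.union_subset ih₁.2 (Qual.inst_subset ih₁.1 ih₂.2)⟩
  | ref _ _ ih₁ ih₂ =>
    exact ⟨Finset.empty_subset _, Finset.union_subset (Finset.union_subset ih₁.2 ih₂.2) ih₁.1⟩
  | deref _ ih => exact ⟨Finset.empty_subset _, Finset.union_subset ih.2 ih.1⟩
  | assign _ _ ih₁ ih₂ =>
    exact ⟨Finset.empty_subset _, Finset.union_subset (Finset.union_subset ih₁.2 ih₂.2) ih₁.1⟩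
  | sub _ _ hq hε => exact ⟨hq, hε⟩

theorem ty_scoped (h : HasType Γ St φ t T q ε) (hΓ : WfEnv Γ St φ) : T.Scoped Γ.length St.dom := by
  induction h with
  | cst => trivial
  | var h _ => exact (hΓ.ctx _ _ _ h).1
  | loc h _ => exact (hΓ.store _ _ _ h).1.mono (Nat.zero_le _) subset_rfl
  | abs hT hp ht hq ih =>
    have hΓ' := (hΓ.mono hq).cons hT hp
    exact ⟨hT, hp, ht.subset_obs.2.trans hΓ'.obs, ih hΓ', ht.subset_obs.1.trans hΓ'.obs⟩
  | app _ _ _ _ _ _ _ ih₁ _ => exact (ih₁ hΓ).2.2.2.1.of_shift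
  | letin ht₁ hd _ ih₁ ih₂ =>
    refine (ih₂ (hΓ.cons (ih₁ hΓ) ?_)).of_shift
    rw [← Finset.coe_subset, hd]
    exact Set.inter_subset_left.trans (hΓ.sat_subset_domOf ht₁.subset_obs.1)
  | ref => trivial
  | deref => trivial
  | assign => trivial
  | sub _ hs _ _ ih => exact hs.1.scoped_iff.1 (ih hΓ)

end HasType

/-! ### Admissible typing rules -/

/-- Terms without computation steps of their own: variables and values. -/
def Tm.IsAnswer (t : Tm S) : Prop := t.IsValue ∨ ∃ i, t = .var i

namespace HasType

variable {Γ : Ctx S} {St : StoreTy S} {φ : Qual} {t t₁ t₂ : Tm S} {T U : Ty S}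
  {p q r d ε ε₁ ε₂ ε₃ : Qual}

theorem weaken_qual (h : HasType Γ St φ t T q ε) (hΓ : WfEnv Γ St φ) {q' ε' : Qual}
    (hq : q ⊆ q') (hq' : q' ⊆ φ) (hε : ε ⊆ ε') (hε' : ε' ⊆ φ) : HasType Γ St φ t T q' ε' :=
  h.sub ⟨.refl (h.ty_scoped hΓ), ⟨hq, hq'.trans hΓ.obs⟩, ⟨hε, hε'.trans hΓ.obs⟩⟩ hq' hε'

/-- By contravariance, the domain qualifier `d` of the function need only contain the overlap of
function and argument. -/
theorem app_of_subset (hΓ : WfEnv Γ St φ)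
    (ht₁ : HasType Γ St φ t₁ (.arr T d ε₃ U.shift r) q ε₁) (ht₂ : HasType Γ St φ t₂ T p ε₂)
    (hd : sat Γ St p ∩ sat Γ St q ⊆ (d : Set Atom))
    (hp : sat Γ St p ⊆ (φ : Set Atom)) (hq : sat Γ St q ⊆ (φ : Set Atom))
    (hε : ε₃ ⊆ q.withVar) (hr : r ⊆ φ.withVar) :
    HasType Γ St φ (.app t₁ t₂) U (Qual.inst p r) (ε₁ ∪ ε₂ ∪ Qual.inst p ε₃) := by
  obtain ⟨d', hd'⟩ := (d.finite_toSet.subset hd).exists_finset_coe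
  obtain ⟨hT, hdφ, hε₃, hU, hrφ⟩ := ht₁.ty_scoped hΓ
  have hdd : d' ⊆ d := Finset.coe_subset.1 (hd' ▸ hd)
  have hsub : Sub Γ St (.arr T d ε₃ U.shift r) (.arr T d' ε₃ U.shift r) :=
    .arr (.refl hT) ⟨hdd, hdφ⟩ (.refl hU) ⟨subset_rfl, hrφ⟩ ⟨subset_rfl, hε₃⟩
  obtain ⟨hqφ, hε₁φ⟩ := ht₁.subset_obs
  exact .app (ht₁.sub ⟨hsub, ⟨subset_rfl, hqφ.trans hΓ.obs⟩, ⟨subset_rfl, hε₁φ.trans hΓ.obs⟩⟩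
    hqφ hε₁φ) ht₂ hd' hp hq hε hr

theorem sat_inter_sat_obs (h : HasType Γ St φ t T q ε) :
    sat Γ St q ∩ sat Γ St φ = sat Γ St q :=
  Set.inter_eq_left.2 (sat_mono _ _ h.subset_obs.1)

theorem letin_of_eq_sat (ht₁ : HasType Γ St φ t₁ T p ε₁) (hd : (d : Set Atom) = sat Γ St p)
    (ht₂ : HasType ((T, d) :: Γ) St φ.withVar t₂ U.shift q ε₂) :
    HasType Γ St φ (.letin t₁ t₂) U (Qual.inst p q) (ε₁ ∪ Qual.inst p ε₂) :=
  .letin ht₁ (hd.trans ht₁.sat_inter_sat_obs.symm) ht₂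

theorem of_isAnswer (h : HasType Γ St φ t T q ε) (ht : t.IsAnswer) {ψ : Qual} (hq : q ⊆ ψ) :
    HasType Γ St ψ t T q ∅ := by
  induction h with
  | cst hc => exact .cst hc
  | var hx _ => exact .var hx (Finset.singleton_subset_iff.1 hq)
  | loc hl _ => exact .loc hl (Finset.singleton_subset_iff.1 hq)
  | abs hT hp hb _ _ => exact .abs hT hp hb hq
  | sub _ hs _ _ ih =>
    exact (ih ht (hs.2.1.1.trans hq)).sub
      ⟨hs.1, hs.2.1, subset_rfl, Finset.empty_subset _⟩ hq (Finset.empty_subset _)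
  | _ => rcases ht with ht | ⟨i, ht⟩ <;> cases ht

end HasType

/-! ### Reachability under binders -/

theorem StoreTy.WellScoped.exists_loc_of_reach {St : StoreTy S} (h : St.WellScoped) {Γ : Ctx S}
    {l : Loc} {b : Atom} (hr : Reach Γ St (aloc l) b) (Δ : Ctx S) :
    ∃ l', b = aloc l' ∧ Reach Δ St (aloc l) (aloc l') := by
  cases hr with
  | loc hl hb =>
    rcases mem_domAtoms.1 ((h _ _ _ hl).2 hb) with ⟨i, hi, -⟩ | ⟨l', -, rfl⟩
    · exact absurd hi (Nat.not_lt_zero i)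
    · exact ⟨l', rfl, .loc hl hb⟩

namespace Reach

variable {Γ : Ctx S} {St : StoreTy S} {a b : Atom}

theorem shift (hSt : St.WellScoped) (h : Reach Γ St a b) (x : Ty S × Qual) :
    Reach (x :: Γ) St (shiftAtom a) (shiftAtom b) := by
  rcases a with i | l
  · cases h with
    | var hi hb => exact .var (hi.succ x) (Qual.shiftAtom_mem_shift.2 hb)
  · obtain ⟨l', rfl, h'⟩ := hSt.exists_loc_of_reach h (x :: Γ)
    exact h'

theorem of_shift (hSt : St.WellScoped) {x : Ty S × Qual} (h : Reach (x :: Γ) St (shiftAtom a) b) :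
    ∃ c, b = shiftAtom c ∧ Reach Γ St a c := by
  rcases a with i | l
  · cases h with
    | var hi hb =>
      cases hi with
      | succ _ hi =>
        obtain ⟨c, hc, rfl⟩ := Qual.mem_shift.1 hb
        exact ⟨c, rfl, .var hi hc⟩
  · obtain ⟨l', rfl, h'⟩ := hSt.exists_loc_of_reach h Γ
    exact ⟨aloc l', rfl, h'⟩

theorem zero_iff {T : Ty S} {q : Qual} : Reach ((T, q) :: Γ) St (avar 0) b ↔ b ∈ q.shift := by
  constructor
  · intro h
    cases h with
    | var hi hb => cases hi; exact hb
  · exact fun h => .var (.zero Γ T q) h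

theorem reflTransGen_shift (hSt : St.WellScoped) (h : Relation.ReflTransGen (Reach Γ St) a b)
    (x : Ty S × Qual) : Relation.ReflTransGen (Reach (x :: Γ) St) (shiftAtom a) (shiftAtom b) :=
  h.lift _ fun _ _ hab => hab.shift hSt x

end Reach

/-! ### Substitutions compatible with reachability -/

/-- The substitution `θ` from `Γ`, `St` to `Δ`, `St'` respects scoping, reflects reachability, and
creates no overlap between the images of atoms in `φ` that is not the image of something reachable
from both. These are the conditions under which `θ` preserves the saturated intersections in the
rules for applications and let bindings. -/
structure Compat (Γ : Ctx S) (St : StoreTy S) (φ : Qual) (Δ : Ctx S) (St' : StoreTy S)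
    (θ : QSubst) : Prop where
  dom : θ.Scoped Γ.length St.dom Δ.length St'.dom
  reach : ∀ a a' b', a' ∈ Qual.substAtom θ a → Reach Δ St' a' b' →
    ∃ b, Relation.ReflTransGen (Reach Γ St) a b ∧ b' ∈ Qual.substAtom θ b
  overlap : ∀ a ∈ φ, ∀ b ∈ φ, ∀ c, c ∈ Qual.substAtom θ a → c ∈ Qual.substAtom θ b →
    ∃ e, Relation.ReflTransGen (Reach Γ St) a e ∧ Relation.ReflTransGen (Reach Γ St) b e ∧
      c ∈ Qual.substAtom θ e

namespace Compat

variable {Γ Δ : Ctx S} {St St' : StoreTy S} {φ : Qual} {θ : QSubst} {T T' : Ty S} {p p' q d : Qual}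

theorem mono (h : Compat Γ St φ Δ St' θ) {ψ : Qual} (hψ : ψ ⊆ φ) : Compat Γ St ψ Δ St' θ :=
  ⟨h.dom, h.reach, fun a ha b hb => h.overlap a (hψ ha) b (hψ hb)⟩

theorem lift_reach (h : Compat Γ St φ Δ St' θ) (hSt : St.WellScoped) (hSt' : St'.WellScoped)
    (hp : p' ⊆ p.subst θ) {a a' b' : Atom} (ha' : a' ∈ Qual.substAtom θ.lift a)
    (hr : Reach ((T', p') :: Δ) St' a' b') :
    ∃ b, Relation.ReflTransGen (Reach ((T, p) :: Γ) St) a b ∧ b' ∈ Qual.substAtom θ.lift b := by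
  rcases Qual.atom_cases a' with rfl | ⟨a', rfl⟩
  · obtain rfl := Qual.zero_mem_substAtom_lift.1 ha'
    have hb' := Qual.shift_mono hp (Reach.zero_iff.1 hr)
    rw [← Qual.subst_lift_shift, Qual.mem_subst] at hb'
    obtain ⟨b, hb, hbb⟩ := hb'
    exact ⟨b, .single (Reach.zero_iff.2 hb), hbb⟩
  · obtain ⟨a, rfl, haa'⟩ := Qual.shiftAtom_mem_substAtom_lift.1 ha'
    obtain ⟨c', rfl, hr'⟩ := hr.of_shift hSt'
    obtain ⟨b, hb, hbb⟩ := h.reach a a' c' haa' hr'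
    exact ⟨shiftAtom b, Reach.reflTransGen_shift hSt hb _,
      Qual.shiftAtom_mem_substAtom_lift.2 ⟨b, rfl, hbb⟩⟩

theorem lift_overlap (h : Compat Γ St φ Δ St' θ) (hSt : St.WellScoped) {a b c : Atom}
    (ha : a ∈ φ.withVar) (hb : b ∈ φ.withVar) (hca : c ∈ Qual.substAtom θ.lift a)
    (hcb : c ∈ Qual.substAtom θ.lift b) (x : Ty S × Qual) :
    ∃ e, Relation.ReflTransGen (Reach (x :: Γ) St) a e ∧
      Relation.ReflTransGen (Reach (x :: Γ) St) b e ∧ c ∈ Qual.substAtom θ.lift e := by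
  rcases Qual.atom_cases c with rfl | ⟨c, rfl⟩
  · obtain rfl := Qual.zero_mem_substAtom_lift.1 hca
    obtain rfl := Qual.zero_mem_substAtom_lift.1 hcb
    exact ⟨_, .refl, .refl, hca⟩
  · obtain ⟨a, rfl, hca₀⟩ := Qual.shiftAtom_mem_substAtom_lift.1 hca
    obtain ⟨b, rfl, hcb₀⟩ := Qual.shiftAtom_mem_substAtom_lift.1 hcb
    rw [Qual.shiftAtom_mem_withVar] at ha hb
    obtain ⟨e, hae, hbe, hce⟩ := h.overlap a ha b hb c hca₀ hcb₀
    exact ⟨shiftAtom e, Reach.reflTransGen_shift hSt hae _, Reach.reflTransGen_shift hSt hbe _,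
      Qual.shiftAtom_mem_substAtom_lift.2 ⟨e, rfl, hce⟩⟩

theorem lift (h : Compat Γ St φ Δ St' θ) (hSt : St.WellScoped) (hSt' : St'.WellScoped)
    (hp : p' ⊆ p.subst θ) : Compat ((T, p) :: Γ) St φ.withVar ((T', p') :: Δ) St' θ.lift where
  dom := h.dom.lift
  reach _ _ _ ha' hr := h.lift_reach hSt hSt' hp ha' hr
  overlap _ ha _ hb _ hca hcb := h.lift_overlap hSt ha hb hca hcb _

theorem exists_of_mem_sat (h : Compat Γ St φ Δ St' θ) {c : Atom}
    (hc : c ∈ sat Δ St' (q.subst θ)) : ∃ a ∈ sat Γ St q, c ∈ Qual.substAtom θ a := by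
  obtain ⟨b, hb, hr⟩ := hc
  induction hr with
  | refl =>
    obtain ⟨a, ha, hab⟩ := Qual.mem_subst.1 hb
    exact ⟨a, subset_sat _ _ _ ha, hab⟩
  | tail _ hr ih =>
    obtain ⟨a, ⟨a₀, ha₀, har⟩, hab⟩ := ih
    obtain ⟨e, he, hce⟩ := h.reach _ _ _ hab hr
    exact ⟨e, ⟨a₀, ha₀, har.trans he⟩, hce⟩

theorem sat_subset_subst (h : Compat Γ St φ Δ St' θ) (hp : sat Γ St p ⊆ (q : Set Atom)) :
    sat Δ St' (p.subst θ) ⊆ (q.subst θ : Set Atom) := by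
  intro c hc
  obtain ⟨a, ha, hca⟩ := h.exists_of_mem_sat hc
  exact Qual.mem_subst.2 ⟨a, hp ha, hca⟩

theorem sat_inter_subset (h : Compat Γ St φ Δ St' θ)
    (hd : (d : Set Atom) = sat Γ St p ∩ sat Γ St q)
    (hp : sat Γ St p ⊆ (φ : Set Atom)) (hq : sat Γ St q ⊆ (φ : Set Atom)) :
    sat Δ St' (p.subst θ) ∩ sat Δ St' (q.subst θ) ⊆ (d.subst θ : Set Atom) := by
  rintro c ⟨hcp, hcq⟩
  obtain ⟨a, ha, hca⟩ := h.exists_of_mem_sat hcp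
  obtain ⟨b, hb, hcb⟩ := h.exists_of_mem_sat hcq
  obtain ⟨e, hae, hbe, hce⟩ := h.overlap a (hp ha) b (hq hb) c hca hcb
  refine Qual.mem_subst.2 ⟨e, ?_, hce⟩
  rw [← Finset.mem_coe, hd]
  obtain ⟨a₀, ha₀, hra⟩ := ha
  obtain ⟨b₀, hb₀, hrb⟩ := hb
  exact ⟨⟨a₀, ha₀, hra.trans hae⟩, ⟨b₀, hb₀, hrb.trans hbe⟩⟩

end Compat

section SubtypingSubst

variable {Γ Δ : Ctx S} {St St' : StoreTy S} {θ : QSubst}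

theorem QSub.subst {p q : Qual} (h : QSub Γ St p q)
    (hθ : θ.Scoped Γ.length St.dom Δ.length St'.dom) : QSub Δ St' (p.subst θ) (q.subst θ) :=
  ⟨Qual.subst_mono θ h.1, hθ.subst_subset h.2⟩

theorem Sub.subst {T U : Ty S} (h : Sub Γ St T U)
    (hθ : θ.Scoped Γ.length St.dom Δ.length St'.dom) : Sub Δ St' (T.subst θ) (U.subst θ) := by
  induction h generalizing Δ θ with
  | base => exact .base ..
  | ref => exact .ref ..
  | arr _ hp _ hq hε ihdom ihcod =>
    exact .arr (ihdom hθ) (hp.subst hθ) (ihcod hθ.lift) (hq.subst hθ.lift) (hε.subst hθ.lift)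

theorem SubQ.subst {T U : Ty S} {p q ε₁ ε₂ : Qual} (h : SubQ Γ St T p ε₁ U q ε₂)
    (hθ : θ.Scoped Γ.length St.dom Δ.length St'.dom) :
    SubQ Δ St' (T.subst θ) (p.subst θ) (ε₁.subst θ) (U.subst θ) (q.subst θ) (ε₂.subst θ) :=
  ⟨h.1.subst hθ, h.2.1.subst hθ, h.2.2.subst hθ⟩

end SubtypingSubst

/-! ### The substitution lemma -/

/-- `W Δ t T q` is a notion of evidence that `t` has type `T` and qualifier `q` in `Δ`, sufficient
for substituting `t` for variables and stable under going below a binder. The substitution lemma is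
proved for every such notion, first for variables, which gives weakening, and then for values. -/
structure SubstKit (St : StoreTy S) (W : Ctx S → Tm S → Ty S → Qual → Prop) : Prop where
  hasType : ∀ {Δ φ t T q}, W Δ t T q → q ⊆ φ → HasType Δ St φ t T q ∅
  var_zero : ∀ Δ T q, W ((T, q) :: Δ) (.var 0) T.shift {avar 0}
  shift : ∀ {Δ t T q b}, W Δ t T q → WfEnv (b :: Δ) St q.shift →
    W (b :: Δ) (t.rename Nat.succ) T.shift q.shift

/-- The simultaneous substitutions `s` of terms and `θ` of qualifiers for variables lead from
`[Γ | Σ]^φ` to the well-formed `[Δ | Σ']^φ'`, with evidence `W` for the terms. -/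
structure TypedSubst (W : Ctx S → Tm S → Ty S → Qual → Prop) (Γ : Ctx S) (St : StoreTy S)
    (φ : Qual) (Δ : Ctx S) (St' : StoreTy S) (φ' : Qual) (θ : QSubst) (s : ℕ → Tm S) : Prop where
  source : St.WellScoped
  extends_store : St'.Extends St
  compat : Compat Γ St φ Δ St' θ
  typed : ∀ {i T q}, InCtx Γ i T q → W Δ (s i) (T.subst θ) (θ i)
  subst_obs : φ.subst θ ⊆ φ'
  target : WfEnv Δ St' φ'

namespace TypedSubst

variable {W : Ctx S → Tm S → Ty S → Qual → Prop} {Γ Δ : Ctx S} {St St' : StoreTy S} {φ φ' : Qual}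
  {θ : QSubst} {s : ℕ → Tm S} {t₁ t₂ : Tm S} {T U : Ty S} {p p' q r d ε₁ ε₂ ε₃ : Qual}

theorem mono (h : TypedSubst W Γ St φ Δ St' φ' θ s) {ψ : Qual} (hψ : ψ ⊆ φ) :
    TypedSubst W Γ St ψ Δ St' (ψ.subst θ) θ s where
  source := h.source
  extends_store := h.extends_store
  compat := h.compat.mono hψ
  typed := h.typed
  subst_obs := subset_rfl
  target := h.target.mono ((Qual.subst_mono θ hψ).trans h.subst_obs)

theorem typed_lift (h : TypedSubst W Γ St φ Δ St' φ' θ s) (kit : SubstKit St' W)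
    {b : Ty S × Qual} (hb : WfEnv (b :: Δ) St' φ'.withVar) (hbT : b.1 = T.subst θ)
    {i : ℕ} (hi : InCtx ((T, p) :: Γ) i U q) :
    W (b :: Δ) (Tm.liftSub s i) (U.subst θ.lift) (θ.lift i) := by
  cases hi with
  | zero =>
    rw [Ty.subst_lift_shift, ← hbT]
    exact kit.var_zero _ _ _
  | succ _ hi =>
    rw [Ty.subst_lift_shift]
    exact kit.shift (h.typed hi)
      ⟨hb.store, hb.ctx, shift_subset_domAtoms (h.compat.dom.var _ hi.lt_length)⟩

theorem lift (h : TypedSubst W Γ St φ Δ St' φ' θ s) (kit : SubstKit St' W)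
    (hT : (T.subst θ).Scoped Δ.length St'.dom) (hp : p' ⊆ domOf Δ St') (hpp : p' ⊆ p.subst θ) :
    TypedSubst W ((T, p) :: Γ) St φ.withVar ((T.subst θ, p') :: Δ) St' φ'.withVar θ.lift
      (Tm.liftSub s) where
  source := h.source
  extends_store := h.extends_store
  compat := h.compat.lift h.source h.target.store hpp
  typed := h.typed_lift kit (h.target.cons hT hp) rfl
  subst_obs := by
    rw [Qual.subst_lift_withVar]
    exact Qual.withVar_mono h.subst_obs
  target := h.target.cons hT hp

theorem app (h : TypedSubst W Γ St φ Δ St' φ' θ s)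
    (ht₁ : HasType Δ St' φ' t₁ ((Ty.arr T d ε₃ U.shift r).subst θ) (q.subst θ) (ε₁.subst θ))
    (ht₂ : HasType Δ St' φ' t₂ (T.subst θ) (p.subst θ) (ε₂.subst θ))
    (hd : (d : Set Atom) = sat Γ St p ∩ sat Γ St q)
    (hp : sat Γ St p ⊆ (φ : Set Atom)) (hq : sat Γ St q ⊆ (φ : Set Atom))
    (hε : ε₃ ⊆ q.withVar) (hr : r ⊆ φ.withVar) :
    HasType Δ St' φ' (.app t₁ t₂) (U.subst θ) ((Qual.inst p r).subst θ)
      ((ε₁ ∪ ε₂ ∪ Qual.inst p ε₃).subst θ) := by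
  have hobs : (φ.subst θ : Set Atom) ⊆ φ' := Finset.coe_subset.2 h.subst_obs
  have hr' : r.subst θ.lift ⊆ φ'.withVar :=
    ((Qual.subst_mono _ hr).trans (Qual.subst_lift_withVar θ φ).subset).trans
      (Qual.withVar_mono h.subst_obs)
  have hε' : ε₃.subst θ.lift ⊆ (q.subst θ).withVar :=
    (Qual.subst_mono _ hε).trans (Qual.subst_lift_withVar θ q).subset
  simp only [Ty.subst, Ty.subst_lift_shift] at ht₁
  simp only [Qual.subst_union, Qual.subst_inst]
  exact .app_of_subset h.target ht₁ ht₂ (h.compat.sat_inter_subset hd hp hq)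
    ((h.compat.sat_subset_subst hp).trans hobs) ((h.compat.sat_subset_subst hq).trans hobs) hε' hr'

theorem letin (h : TypedSubst W Γ St φ Δ St' φ' θ s) (kit : SubstKit St' W)
    (ht₁ : HasType Δ St' φ' t₁ (T.subst θ) (p.subst θ) (ε₁.subst θ))
    (hd : sat Γ St p ⊆ (d : Set Atom))
    (ht₂ : ∀ {Δ' φ'' θ' s'}, TypedSubst W ((T, d) :: Γ) St φ.withVar Δ' St' φ'' θ' s' →
      HasType Δ' St' φ'' (t₂.subst s') (U.shift.subst θ') (q.subst θ') (ε₂.subst θ')) :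
    HasType Δ St' φ' (.letin t₁ (t₂.subst (Tm.liftSub s))) (U.subst θ) ((Qual.inst p q).subst θ)
      ((ε₁ ∪ Qual.inst p ε₂).subst θ) := by
  have hsat := h.compat.sat_subset_subst hd
  obtain ⟨d', hd'⟩ := ((d.subst θ).finite_toSet.subset hsat).exists_finset_coe
  have hdd : d' ⊆ d.subst θ := Finset.coe_subset.1 (hd' ▸ hsat)
  have hdom : d' ⊆ domOf Δ St' :=
    Finset.coe_subset.1 (hd' ▸ h.target.sat_subset_domOf ht₁.subset_obs.1)
  have ht₂' := ht₂ (h.lift kit (ht₁.ty_scoped h.target) hdom hdd)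
  rw [Ty.subst_lift_shift] at ht₂'
  simp only [Qual.subst_union, Qual.subst_inst]
  exact .letin_of_eq_sat ht₁ hd' ht₂'

end TypedSubst

theorem HasType.subst {W : Ctx S → Tm S → Ty S → Qual → Prop} {Γ Δ : Ctx S} {St St' : StoreTy S}
    {φ φ' : Qual} {θ : QSubst} {s : ℕ → Tm S} {t : Tm S} {T : Ty S} {q ε : Qual}
    (h : HasType Γ St φ t T q ε) (kit : SubstKit St' W) (hs : TypedSubst W Γ St φ Δ St' φ' θ s) :
    HasType Δ St' φ' (t.subst s) (T.subst θ) (q.subst θ) (ε.subst θ) := by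
  induction h generalizing Δ φ' θ s with
  | cst hc => exact .cst hc
  | var hx hv =>
    rw [Qual.subst_singleton]
    exact kit.hasType (hs.typed hx) ((Qual.substAtom_subset_subst hv).trans hs.subst_obs)
  | loc hl hv =>
    rw [(hs.source _ _ _ hl).1.subst_closed, Qual.subst_singleton]
    exact .loc (hs.extends_store _ _ hl) (hs.subst_obs (Qual.mem_subst.2 ⟨_, hv, by simp⟩))
  | abs hT hp _ hq ih =>
    have hT' := hs.compat.dom.ty_subst hT
    have hp' := hs.compat.dom.subst_subset hp
    exact .abs hT' hp' (ih ((hs.mono hq).lift kit hT' hp' subset_rfl))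
      ((Qual.subst_mono θ hq).trans hs.subst_obs)
  | app _ _ hd hp hq hε hr ih₁ ih₂ => exact hs.app (ih₁ hs) (ih₂ hs) hd hp hq hε hr
  | letin ht₁ hd _ ih₁ ih₂ =>
    exact hs.letin kit (ih₁ hs) (hd.trans ht₁.sat_inter_sat_obs).ge ih₂
  | ref _ _ ih₁ ih₂ =>
    rw [Qual.subst_union, Qual.subst_union]
    exact .ref (ih₁ hs) (ih₂ hs)
  | deref _ ih =>
    rw [Qual.subst_union]
    exact .deref (ih hs)
  | assign _ _ ih₁ ih₂ =>
    rw [Qual.subst_union, Qual.subst_union]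
    exact .assign (ih₁ hs) (ih₂ hs)
  | sub _ hsub hq hε ih =>
    exact (ih hs).sub (hsub.subst hs.compat.dom) ((Qual.subst_mono θ hq).trans hs.subst_obs)
      ((Qual.subst_mono θ hε).trans hs.subst_obs)

/-! ### Weakening -/

theorem Tm.liftSub_var (ρ : ℕ → ℕ) :
    Tm.liftSub (fun i => Tm.var (S := S) (ρ i)) = fun i => Tm.var (liftRen ρ i) := by
  funext i
  cases i <;> rfl

theorem Tm.rename_eq_subst (ρ : ℕ → ℕ) (t : Tm S) : t.rename ρ = t.subst fun i => .var (ρ i) := by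
  induction t generalizing ρ <;> simp_all [Tm.rename, Tm.subst, Tm.liftSub_var]

theorem Tm.subst_var (t : Tm S) : t.subst Tm.var = t := by
  have h : Tm.liftSub (Tm.var (S := S)) = Tm.var := by
    funext i
    cases i <;> rfl
  induction t <;> simp_all [Tm.subst]

theorem Qual.substAtom_ofRen (ρ : ℕ → ℕ) (a : Atom) :
    substAtom (QSubst.ofRen ρ) a = {Sum.map ρ id a} := by
  rcases a with i | l <;> rfl

theorem InCtx.hasType_var {Γ : Ctx S} {St : StoreTy S} {φ : Qual} {i : ℕ} {T : Ty S} {q : Qual}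
    (h : InCtx Γ i T q) (hφ : {avar i} ⊆ φ) : HasType Γ St φ (.var i) T {avar i} ∅ :=
  .var h (Finset.singleton_subset_iff.1 hφ)

theorem SubstKit.variables (St : StoreTy S) :
    SubstKit St fun Γ t T q => ∃ i d, t = .var i ∧ q = {avar i} ∧ InCtx Γ i T d where
  hasType := by
    rintro Δ φ _ T _ ⟨i, d, rfl, rfl, hi⟩ hφ
    exact hi.hasType_var hφ
  var_zero Δ T q := ⟨0, _, rfl, rfl, .zero ..⟩
  shift := by
    rintro Δ _ T _ b ⟨i, d, rfl, rfl, hi⟩ -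
    exact ⟨i + 1, _, rfl, rfl, hi.succ b⟩

theorem Compat.succ {Γ : Ctx S} {St : StoreTy S} (hSt : St.WellScoped) (φ : Qual)
    (b : Ty S × Qual) : Compat Γ St φ (b :: Γ) St (QSubst.ofRen Nat.succ) where
  dom := QSubst.scoped_succ _ _
  reach a a' b' ha' hr := by
    rw [Qual.substAtom_ofRen, Finset.mem_singleton] at ha'
    subst ha'
    obtain ⟨c, rfl, hc⟩ := hr.of_shift hSt
    exact ⟨c, .single hc, by rw [Qual.substAtom_ofRen]; exact Finset.mem_singleton_self _⟩
  overlap a _ b _ c hca hcb := by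
    have hab : shiftAtom a = shiftAtom b := by
      rw [Qual.substAtom_ofRen, Finset.mem_singleton] at hca hcb
      exact hca.symm.trans hcb
    obtain rfl := Qual.shiftAtom_injective hab
    exact ⟨a, .refl, .refl, hca⟩

theorem HasType.shift {Γ : Ctx S} {St : StoreTy S} {φ : Qual} {t : Tm S} {T : Ty S}
    {q ε : Qual} (h : HasType Γ St φ t T q ε) {b : Ty S × Qual}
    (hb : WfEnv (b :: Γ) St φ.shift) :
    HasType (b :: Γ) St φ.shift (t.rename Nat.succ) T.shift q.shift ε.shift := by
  rw [Tm.rename_eq_subst, Ty.shift_eq_subst, Qual.shift_eq_subst q, Qual.shift_eq_subst ε]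
  exact h.subst (.variables St)
    { source := hb.store
      extends_store := fun _ _ h => h
      compat := .succ hb.store φ b
      typed := fun hi => ⟨_, _, rfl, rfl, Ty.shift_eq_subst _ ▸ hi.succ b⟩
      subst_obs := (Qual.shift_eq_subst φ).ge
      target := hb }

theorem Tm.IsAnswer.rename {t : Tm S} (h : t.IsAnswer) (ρ : ℕ → ℕ) : (t.rename ρ).IsAnswer := by
  rcases h with h | ⟨i, rfl⟩
  · refine .inl ?_
    cases h <;> constructor
  · exact .inr ⟨_, rfl⟩

theorem SubstKit.answers (St : StoreTy S) :
    SubstKit St fun Γ t T q => t.IsAnswer ∧ HasType Γ St q t T q ∅ where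
  hasType ht hq := ht.2.of_isAnswer ht.1 hq
  var_zero _ _ _ := ⟨.inr ⟨0, rfl⟩, InCtx.hasType_var (.zero ..) subset_rfl⟩
  shift ht hb := ⟨ht.1.rename _, ht.2.shift hb⟩

/-! ### First-order store typings -/

namespace StoreTy

variable {St : StoreTy S}

/-- First-order store typings: every location holds a base or reference type and reaches nothing.
All store typings of well-formed stores are of this form. -/
def Flat (St : StoreTy S) : Prop :=
  ∀ (l : Loc) (T : Ty S) (q : Qual), St.lookup l = some (T, q) →
    q = ∅ ∧ ((∃ B, T = .base B) ∨ ∃ B, T = .ref B)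

theorem Flat.wellScoped (h : St.Flat) : St.WellScoped := by
  intro l T q hl
  obtain ⟨rfl, ⟨B, rfl⟩ | ⟨B, rfl⟩⟩ := h l T q hl <;> exact ⟨trivial, Finset.empty_subset _⟩

theorem Flat.not_reach (h : St.Flat) {Γ : Ctx S} {l : Loc} {b : Atom} :
    ¬ Reach Γ St (aloc l) b := by
  rintro (_ | ⟨hl, hb⟩)
  rw [(h _ _ _ hl).1] at hb
  exact Finset.notMem_empty _ hb

theorem Flat.not_reach_nil (h : St.Flat) {a b : Atom} : ¬ Reach [] St a b := by
  rcases a with i | l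
  · rintro (⟨⟨⟩, _⟩ | _)
  · exact h.not_reach

theorem Flat.sat_nil (h : St.Flat) (q : Qual) : sat [] St q = q := by
  refine Set.Subset.antisymm ?_ (subset_sat _ _ q)
  rintro b ⟨a, ha, hab⟩
  cases hab with
  | refl => exact ha
  | tail _ hr => exact absurd hr h.not_reach_nil

theorem Extends.dom_subset {St' : StoreTy S} (h : St'.Extends St) : St.dom ⊆ St'.dom := by
  intro l hl
  obtain ⟨b, hb⟩ := StoreTy.mem_dom.1 hl
  exact StoreTy.mem_dom.2 ⟨b, h l b hb⟩

theorem Extends.obs_subset {St' : StoreTy S} (h : St'.Extends St) : St.obs ⊆ St'.obs :=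
  Finset.image_subset_image h.dom_subset

end StoreTy

theorem HasType.weaken_store {Γ : Ctx S} {St St' : StoreTy S} {φ φ' : Qual} {t : Tm S} {T : Ty S}
    {q ε : Qual} (h : HasType Γ St φ t T q ε) (hSt : St.WellScoped) (hflat : St'.Flat)
    (hE : St'.Extends St) (hΓ : WfEnv Γ St' φ') (hφ : φ ⊆ φ') : HasType Γ St' φ' t T q ε := by
  have hcompat : Compat Γ St φ Γ St' (QSubst.ofRen id) :=
    { dom := QSubst.scoped_ofRen (fun _ hi => hi) hE.dom_subset
      reach := by
        intro a a' b' ha' hr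
        simp only [Qual.substAtom_ofRen, Sum.map_id_id, id, Finset.mem_singleton] at ha' ⊢
        subst ha'
        cases hr with
        | var hi hb => exact ⟨b', .single (.var hi hb), rfl⟩
        | loc hl hb => exact absurd (.loc hl hb) (hflat.not_reach (Γ := Γ))
      overlap := by
        intro a _ b _ c hca hcb
        simp only [Qual.substAtom_ofRen, Sum.map_id_id, id, Finset.mem_singleton] at hca hcb ⊢
        subst hca hcb
        exact ⟨c, .refl, .refl, rfl⟩ }
  have := h.subst (s := Tm.var) (.answers St')
    { source := hSt
      extends_store := hE
      compat := hcompat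
      typed := fun hi => ⟨.inr ⟨_, rfl⟩, Ty.subst_ofRen_id _ ▸ hi.hasType_var subset_rfl⟩
      subst_obs := by rwa [Qual.subst_ofRen_id]
      target := hΓ }
  simpa only [Qual.subst_ofRen_id, Ty.subst_ofRen_id, Tm.subst_var] using this

/-! ### Removing non-base atoms from the qualifiers of base types -/

/-- A set of atoms, meant to be those bound with a base type. -/
abbrev Marking := Atom → Bool

/-- Extend a marking under one binder, whose variable is marked if `b`. -/
def Marking.lift (β : Marking) (b : Bool) : Marking
  | Sum.inl 0 => b
  | Sum.inl (i + 1) => β (Sum.inl i)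
  | Sum.inr l => β (Sum.inr l)

namespace Marking

@[simp] theorem lift_zero (β : Marking) (b : Bool) : β.lift b (avar 0) = b := rfl

@[simp] theorem lift_shiftAtom (β : Marking) (b : Bool) (a : Atom) :
    β.lift b (shiftAtom a) = β a := by
  rcases a with i | l <;> rfl

theorem lift_comp (β : Marking) (b : Bool) (ρ : ℕ → ℕ) :
    β.lift b ∘ Sum.map (liftRen ρ) id = lift (β ∘ Sum.map ρ id) b := by
  funext a
  rcases a with (_ | i) | l <;> rfl

end Marking

namespace Qual

/-- Restrict `q` to the marked atoms if `b`, which says that `q` qualifies a base type. -/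
def restrict (β : Marking) (b : Bool) (q : Qual) : Qual := if b then q.filter fun a => β a else q

theorem mem_restrict {β : Marking} {b : Bool} {q : Qual} {a : Atom} :
    a ∈ restrict β b q ↔ a ∈ q ∧ (b = true → β a = true) := by
  cases b <;> simp [restrict]

theorem restrict_subset (β : Marking) (b : Bool) (q : Qual) : restrict β b q ⊆ q :=
  fun _ ha => (mem_restrict.1 ha).1

theorem restrict_mono (β : Marking) (b : Bool) {p q : Qual} (h : p ⊆ q) :
    restrict β b p ⊆ restrict β b q :=
  fun _ ha => mem_restrict.2 ⟨h (mem_restrict.1 ha).1, (mem_restrict.1 ha).2⟩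

theorem restrict_singleton {β : Marking} {b : Bool} {a : Atom} (h : β a = b) :
    restrict β b {a} = {a} := by
  subst h
  ext c
  rw [mem_restrict, Finset.mem_singleton]
  exact ⟨And.left, by rintro rfl; exact ⟨rfl, id⟩⟩

theorem restrict_rename (β : Marking) (b : Bool) (ρ : ℕ → ℕ) (q : Qual) :
    restrict β b (rename ρ q) = rename ρ (restrict (β ∘ Sum.map ρ id) b q) := by
  cases b
  · rfl
  · exact Finset.filter_image

theorem restrict_shift (β : Marking) (b c : Bool) (q : Qual) :
    restrict (β.lift b) c q.shift = (restrict β c q).shift :=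
  (restrict_rename ..).trans <|
    congrArg (fun β => (restrict β c q).shift) (funext (Marking.lift_shiftAtom β b))

theorem inst_restrict_subset (β : Marking) (b c : Bool) (p r : Qual) :
    inst (restrict β b p) (restrict (β.lift b) c r) ⊆ restrict β c (inst p r) := by
  intro a ha
  simp only [mem_inst, mem_restrict, Marking.lift_zero, Marking.lift_shiftAtom] at ha ⊢
  tauto

end Qual

namespace Ty

/-- Whether a type is a base type. -/
def isBase : Ty S → Bool
  | base _ => true
  | _ => false

/-- Restrict the qualifiers of all base types within a type to the marked atoms and the bound
variables of base type. -/
def restrict : Marking → Ty S → Ty S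
  | _, base B => base B
  | _, ref B => ref B
  | β, arr T p ε U r =>
      arr (restrict β T) (Qual.restrict β T.isBase p) ε (restrict (β.lift T.isBase) U)
        (Qual.restrict (β.lift T.isBase) U.isBase r)

@[simp] theorem isBase_rename (ρ : ℕ → ℕ) (T : Ty S) : (rename ρ T).isBase = T.isBase := by
  cases T <;> rfl

@[simp] theorem isBase_shift (T : Ty S) : T.shift.isBase = T.isBase := isBase_rename _ T

theorem restrict_rename (β : Marking) (ρ : ℕ → ℕ) (T : Ty S) :
    restrict β (rename ρ T) = rename ρ (restrict (β ∘ Sum.map ρ id) T) := by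
  induction T generalizing β ρ with
  | base B => rfl
  | ref B => rfl
  | arr T p ε U r ihT ihU =>
    simp only [rename, restrict, isBase_rename, ihT, ihU, Qual.restrict_rename, Marking.lift_comp]

theorem restrict_shift (β : Marking) (b : Bool) (T : Ty S) :
    restrict (β.lift b) T.shift = (restrict β T).shift :=
  (restrict_rename ..).trans <|
    congrArg (fun β => (restrict β T).shift) (funext (Marking.lift_shiftAtom β b))

theorem Scoped.restrict {T : Ty S} {n : ℕ} {D : Finset Loc} (h : T.Scoped n D) (β : Marking) :
    (T.restrict β).Scoped n D := by
  induction T generalizing β n with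
  | base B => trivial
  | ref B => trivial
  | arr T p ε U r ihT ihU =>
    obtain ⟨hT, hp, hε, hU, hr⟩ := h
    exact ⟨ihT hT _, (Qual.restrict_subset ..).trans hp, hε, ihU hU _,
      (Qual.restrict_subset ..).trans hr⟩

end Ty

theorem Sub.isBase_eq {Γ : Ctx S} {St : StoreTy S} {T U : Ty S} (h : Sub Γ St T U) :
    T.isBase = U.isBase := by
  cases h <;> rfl

theorem Sub.restrict {Γ Δ : Ctx S} {St : StoreTy S} {T U : Ty S} (h : Sub Γ St T U)
    (β : Marking) (hΔ : Γ.length = Δ.length) : Sub Δ St (T.restrict β) (U.restrict β) := by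
  induction h generalizing Δ β with
  | base => exact .base ..
  | ref => exact .ref ..
  | arr hdom hp hcod hq hε ihdom ihcod =>
    simp only [QSub, domOf, List.length_cons, hΔ] at hp hq hε
    simp only [Ty.restrict, hdom.isBase_eq, hcod.isBase_eq]
    exact .arr (ihdom β hΔ)
      ⟨Qual.restrict_mono _ _ hp.1, (Qual.restrict_subset ..).trans hp.2⟩
      (ihcod _ (congrArg Nat.succ hΔ))
      ⟨Qual.restrict_mono _ _ hq.1, (Qual.restrict_subset ..).trans hq.2⟩ hε

/-- `Restricts β St Γ Δ`: the marking `β` tells the atoms of base type in `Γ` and `St`, and `Δ`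
binds the variables of `Γ` with restricted types and at most the restricted qualifiers. -/
inductive Restricts : Marking → StoreTy S → Ctx S → Ctx S → Prop
  | nil {β : Marking} {St : StoreTy S}
      (hβ : ∀ l T q, St.lookup l = some (T, q) → β (aloc l) = T.isBase) : Restricts β St [] []
  | cons {β : Marking} {St : StoreTy S} {Γ Δ : Ctx S} {T : Ty S} {q q' : Qual}
      (h : Restricts β St Γ Δ) (hq : q' ⊆ q.restrict β T.isBase) :
      Restricts (β.lift T.isBase) St ((T, q) :: Γ) ((T.restrict β, q') :: Δ)

namespace Restricts

variable {β : Marking} {St : StoreTy S} {Γ Δ : Ctx S} {φ : Qual} {t₁ t₂ : Tm S} {T U : Ty S}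
  {p q r d ε₁ ε₂ ε₃ : Qual}

theorem length_eq (h : Restricts β St Γ Δ) : Γ.length = Δ.length := by
  induction h with
  | nil => rfl
  | cons _ _ ih => exact congrArg Nat.succ ih

theorem aloc_eq (h : Restricts β St Γ Δ) {l : Loc} (hl : St.lookup l = some (T, q)) :
    β (aloc l) = T.isBase := by
  induction h with
  | nil hβ => exact hβ _ _ _ hl
  | cons _ _ ih => exact ih hl

theorem avar_eq (h : Restricts β St Γ Δ) {i : ℕ} (hi : InCtx Γ i T q) :
    β (avar i) = T.isBase := by
  induction h generalizing i T q with
  | nil => cases hi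
  | cons _ _ ih =>
    cases hi with
    | zero => exact (Ty.isBase_shift _).symm
    | succ _ hi => exact (ih hi).trans (Ty.isBase_shift _).symm

theorem exists_inCtx (h : Restricts β St Γ Δ) {i : ℕ} (hi : InCtx Γ i T q) :
    ∃ q', InCtx Δ i (T.restrict β) q' := by
  induction h generalizing i T q with
  | nil => cases hi
  | cons _ _ ih =>
    cases hi with
    | zero => exact ⟨_, by rw [Ty.restrict_shift]; exact .zero ..⟩
    | succ _ hi =>
      obtain ⟨q', hi'⟩ := ih hi
      exact ⟨_, by rw [Ty.restrict_shift]; exact hi'.succ _⟩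

theorem exists_of_inCtx (h : Restricts β St Γ Δ) {i : ℕ} (hi : InCtx Δ i T q) :
    ∃ U r, InCtx Γ i U r ∧ q ⊆ r.restrict β U.isBase := by
  induction h generalizing i T q with
  | nil => cases hi
  | cons _ hq ih =>
    cases hi with
    | zero =>
      refine ⟨_, _, .zero .., ?_⟩
      rw [Ty.isBase_shift, Qual.restrict_shift]
      exact Qual.shift_mono hq
    | succ _ hi =>
      obtain ⟨U, r, hi', hr⟩ := ih hi
      refine ⟨_, _, hi'.succ _, ?_⟩
      rw [Ty.isBase_shift, Qual.restrict_shift]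
      exact Qual.shift_mono hr

theorem reach (h : Restricts β St Γ Δ) (hSt : St.Flat) {a b : Atom} (hr : Reach Δ St a b) :
    Reach Γ St a b ∧ (β a = true → β b = true) := by
  cases hr with
  | var hi hb =>
    obtain ⟨U, r, hi', hr⟩ := h.exists_of_inCtx hi
    obtain ⟨hb, hβ⟩ := Qual.mem_restrict.1 (hr hb)
    exact ⟨.var hi' hb, h.avar_eq hi' ▸ hβ⟩
  | loc hl hb => exact absurd (.loc hl hb) (hSt.not_reach (Γ := Δ))

theorem sat_restrict (h : Restricts β St Γ Δ) (hSt : St.Flat) {b : Bool} {c : Atom}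
    (hc : c ∈ sat Δ St (p.restrict β b)) : c ∈ sat Γ St p ∧ (b = true → β c = true) := by
  obtain ⟨a, ha, hr⟩ := hc
  obtain ⟨hap, hβ⟩ := Qual.mem_restrict.1 ha
  induction hr with
  | refl => exact ⟨⟨_, hap, .refl⟩, hβ⟩
  | tail _ hcd ih =>
    obtain ⟨⟨a₀, ha₀, hr⟩, hb⟩ := ih
    obtain ⟨hcd, hβcd⟩ := h.reach hSt hcd
    exact ⟨⟨a₀, ha₀, hr.tail hcd⟩, hβcd ∘ hb⟩

theorem sat_subset (h : Restricts β St Γ Δ) (hSt : St.Flat) (b : Bool) (p : Qual) :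
    sat Δ St (p.restrict β b) ⊆ sat Γ St p :=
  fun _ hc => (h.sat_restrict hSt hc).1

theorem app (h : Restricts β St Γ Δ) (hSt : St.Flat) (hΔ : WfEnv Δ St φ)
    (ht₁ : HasType Δ St φ t₁ ((Ty.arr T d ε₃ U.shift r).restrict β) q ε₁)
    (ht₂ : HasType Δ St φ t₂ (T.restrict β) (p.restrict β T.isBase) ε₂)
    (hd : (d : Set Atom) = sat Γ St p ∩ sat Γ St q)
    (hp : sat Γ St p ⊆ (φ : Set Atom)) (hq : sat Γ St q ⊆ (φ : Set Atom))
    (hε : ε₃ ⊆ q.withVar) (hr : r ⊆ φ.withVar) :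
    HasType Δ St φ (.app t₁ t₂) (U.restrict β) ((Qual.inst p r).restrict β U.isBase)
      (ε₁ ∪ ε₂ ∪ Qual.inst p ε₃) := by
  simp only [Ty.restrict, Ty.restrict_shift, Ty.isBase_shift] at ht₁
  have hdom : sat Δ St (p.restrict β T.isBase) ∩ sat Δ St q ⊆
      (d.restrict β T.isBase : Set Atom) := by
    rintro c ⟨hcp, hcq⟩
    obtain ⟨hcp, hβ⟩ := h.sat_restrict hSt hcp
    exact Qual.mem_restrict.2 ⟨Finset.mem_coe.1 (hd ▸ ⟨hcp, h.sat_subset hSt false q hcq⟩), hβ⟩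
  have hpφ : p ⊆ φ := Finset.coe_subset.1 ((subset_sat _ _ p).trans hp)
  have happ := HasType.app_of_subset hΔ ht₁ ht₂ hdom ((h.sat_subset hSt _ p).trans hp)
    ((h.sat_subset hSt false q).trans hq) hε ((Qual.restrict_subset ..).trans hr)
  refine happ.weaken_qual hΔ (Qual.inst_restrict_subset ..)
    ((Qual.restrict_subset ..).trans (Qual.inst_subset hpφ hr))
    (Finset.union_subset_union subset_rfl (Qual.inst_mono (Qual.restrict_subset ..) subset_rfl)) ?_
  exact Finset.union_subset (Finset.union_subset ht₁.subset_obs.2 ht₂.subset_obs.2)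
    (Qual.inst_subset hpφ (hε.trans (Qual.withVar_mono ht₁.subset_obs.1)))

theorem letin (h : Restricts β St Γ Δ) (hSt : St.Flat) (hΔ : WfEnv Δ St φ)
    (ht₁ : HasType Δ St φ t₁ (T.restrict β) (p.restrict β T.isBase) ε₁)
    (hpφ : p ⊆ φ) (hd : sat Γ St p ⊆ (d : Set Atom)) (hq : q ⊆ φ.withVar)
    (ht₂ : ∀ {Δ'}, Restricts (β.lift T.isBase) St ((T, d) :: Γ) Δ' → WfEnv Δ' St φ.withVar →
      HasType Δ' St φ.withVar t₂ (U.shift.restrict (β.lift T.isBase))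
        (q.restrict (β.lift T.isBase) U.shift.isBase) ε₂) :
    HasType Δ St φ (.letin t₁ t₂) (U.restrict β) ((Qual.inst p q).restrict β U.isBase)
      (ε₁ ∪ Qual.inst p ε₂) := by
  have hsat : sat Δ St (p.restrict β T.isBase) ⊆ (d.restrict β T.isBase : Set Atom) := by
    intro c hc
    obtain ⟨hcp, hβ⟩ := h.sat_restrict hSt hc
    exact Qual.mem_restrict.2 ⟨hd hcp, hβ⟩
  obtain ⟨d', hd'⟩ := ((d.restrict β T.isBase).finite_toSet.subset hsat).exists_finset_coe
  have hdom : d' ⊆ domOf Δ St :=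
    Finset.coe_subset.1 (hd' ▸ hΔ.sat_subset_domOf ht₁.subset_obs.1)
  have ht₂' := ht₂ (h.cons (Finset.coe_subset.1 (hd' ▸ hsat))) (hΔ.cons (ht₁.ty_scoped hΔ) hdom)
  rw [Ty.restrict_shift, Ty.isBase_shift] at ht₂'
  exact (HasType.letin_of_eq_sat ht₁ hd' ht₂').weaken_qual hΔ (Qual.inst_restrict_subset ..)
    ((Qual.restrict_subset ..).trans (Qual.inst_subset hpφ hq))
    (Finset.union_subset_union subset_rfl (Qual.inst_mono (Qual.restrict_subset ..) subset_rfl))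
    (Finset.union_subset ht₁.subset_obs.2 (Qual.inst_subset hpφ ht₂'.subset_obs.2))

end Restricts

namespace HasType

variable {St : StoreTy S} {φ : Qual} {t : Tm S} {q ε : Qual}

theorem restrict {Γ Δ : Ctx S} {T : Ty S} {β : Marking} (h : HasType Γ St φ t T q ε)
    (hβ : Restricts β St Γ Δ) (hSt : St.Flat) (hΔ : WfEnv Δ St φ) :
    HasType Δ St φ t (T.restrict β) (q.restrict β T.isBase) ε := by
  induction h generalizing Δ β with
  | cst hc => exact .cst hc
  | var hx hv =>
    obtain ⟨q', hx'⟩ := hβ.exists_inCtx hx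
    rw [Qual.restrict_singleton (hβ.avar_eq hx)]
    exact .var hx' hv
  | loc hl hv =>
    rw [Qual.restrict_singleton (hβ.aloc_eq hl)]
    obtain ⟨-, ⟨B, rfl⟩ | ⟨B, rfl⟩⟩ := hSt _ _ _ hl <;> exact .loc hl hv
  | @abs Γ St φ _ T _ p _ _ _ hT hp _ hq ih =>
    have hT' := hβ.length_eq ▸ hT.restrict β
    rw [domOf, hβ.length_eq] at hp
    have hp' := (Qual.restrict_subset β T.isBase p).trans hp
    exact .abs hT' hp' (ih (hβ.cons subset_rfl) hSt ((hΔ.mono hq).cons hT' hp')) hq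
  | app _ _ hd hp hq hε hr ih₁ ih₂ =>
    exact hβ.app hSt hΔ (ih₁ hβ hSt hΔ) (ih₂ hβ hSt hΔ) hd hp hq hε hr
  | letin ht₁ hd ht₂ ih₁ ih₂ =>
    exact hβ.letin hSt hΔ (ih₁ hβ hSt hΔ) ht₁.subset_obs.1 (hd.trans ht₁.sat_inter_sat_obs).ge
      ht₂.subset_obs.1 fun hβ' => ih₂ hβ' hSt
  | ref ht₁ ht₂ ih₁ ih₂ =>
    exact (HasType.ref (ih₁ hβ hSt hΔ) (ih₂ hβ hSt hΔ)).weaken_qual hΔ subset_rfl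
      (Finset.empty_subset _) (Finset.union_subset_union subset_rfl (Qual.restrict_subset ..))
      (HasType.ref ht₁ ht₂).subset_obs.2
  | deref _ ih => exact .deref (ih hβ hSt hΔ)
  | assign _ _ ih₁ ih₂ => exact .assign (ih₁ hβ hSt hΔ) (ih₂ hβ hSt hΔ)
  | @sub Γ St φ _ T _ _ q _ _ _ hs hq hε ih =>
    have hq' := (Qual.restrict_subset β T.isBase q).trans hq
    rw [← hs.1.isBase_eq]
    exact (ih hβ hSt hΔ).sub ⟨hs.1.restrict β hβ.length_eq,
      ⟨Qual.restrict_mono β _ hs.2.1.1, hq'.trans hΔ.obs⟩, ⟨hs.2.2.1, hε.trans hΔ.obs⟩⟩ hq' hε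

theorem restrict_base {B : S.Base} {q' : Qual} (h : HasType [] St St.obs t (.base B) q ε)
    (hSt : St.Flat) (hq' : q' ⊆ q)
    (hq : ∀ l, aloc l ∈ q → aloc l ∉ q' → ∃ C r, St.lookup l = some (.ref C, r)) :
    HasType [] St St.obs t (.base B) q' ε := by
  let β : Marking := Sum.elim (fun _ => false) fun l =>
    ((St.lookup l).map fun b => b.1.isBase).getD false
  have hβ : Restricts β St [] [] := .nil fun l T q hl => by simp [β, hl]
  have hΓ := hSt.wellScoped.wfEnv
  refine (h.restrict hβ hSt hΓ).weaken_qual hΓ ?_ (hq'.trans h.subset_obs.1) subset_rfl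
    h.subset_obs.2
  intro a ha
  obtain ⟨haq, hmarked⟩ := Qual.mem_restrict.1 ha
  rcases a with i | l
  · cases hmarked rfl
  · by_contra hn
    obtain ⟨C, r, hl⟩ := hq l haq hn
    simp [β, hl, Ty.isBase] at hmarked

end HasType

/-! ### Substitution of a value -/

theorem Qual.mem_substAtom_single {p : Qual} {a c : Atom} :
    c ∈ substAtom (QSubst.single p) a ↔ a = avar 0 ∧ c ∈ p ∨ a = shiftAtom c := by
  rcases a with (_ | i) | l <;> rcases c with j | k <;>
    simp [QSubst.single, shiftAtom, eq_comm]

theorem QSubst.scoped_single {n : ℕ} {D : Finset Loc} {p : Qual} (hp : p ⊆ domAtoms n D) :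
    (QSubst.single p).Scoped (n + 1) D n D where
  var i hi := by
    rcases i with _ | i
    · exact hp
    · exact Finset.singleton_subset_iff.2 (avar_mem_domAtoms.2 (Nat.lt_of_succ_lt_succ hi))
  loc := subset_rfl

theorem Compat.single {Γ : Ctx S} {St : StoreTy S} {T : Ty S} {p d ψ : Qual}
    (hSt : St.WellScoped) (hp : p ⊆ domOf Γ St) (hsat : sat Γ St p ⊆ (p : Set Atom))
    (hd : p ∩ ψ ⊆ d) : Compat ((T, d) :: Γ) St ψ.withVar Γ St (QSubst.single p) := by
  have hreach : ∀ c ∈ p, shiftAtom c ∈ ψ.withVar →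
      Relation.ReflTransGen (Reach ((T, d) :: Γ) St) (avar 0) (shiftAtom c) := fun c hcp hcψ =>
    .single (Reach.zero_iff.2 (Qual.shiftAtom_mem_shift.2
      (hd (Finset.mem_inter.2 ⟨hcp, Qual.shiftAtom_mem_withVar.1 hcψ⟩))))
  refine ⟨QSubst.scoped_single hp, fun a a' b' ha' hr => ?_, fun a ha b hb c hca hcb => ?_⟩
  · rcases Qual.mem_substAtom_single.1 ha' with ⟨rfl, hp'⟩ | rfl
    · exact ⟨avar 0, .refl, Qual.mem_substAtom_single.2 (.inl ⟨rfl, hsat ⟨a', hp', .single hr⟩⟩)⟩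
    · exact ⟨_, .single (hr.shift hSt _), Qual.mem_substAtom_single.2 (.inr rfl)⟩
  · rcases Qual.mem_substAtom_single.1 hca with ⟨rfl, hcp⟩ | rfl <;>
      rcases Qual.mem_substAtom_single.1 hcb with ⟨rfl, hcp'⟩ | rfl
    · exact ⟨_, .refl, .refl, hca⟩
    · exact ⟨_, hreach c hcp hb, .refl, hcb⟩
    · exact ⟨_, .refl, hreach c hcp' ha, hca⟩
    · exact ⟨_, .refl, .refl, hca⟩

namespace HasType

variable {Γ : Ctx S} {St : StoreTy S} {φ : Qual} {t v : Tm S} {T U : Ty S} {p q d r ε : Qual}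

theorem inst {ψ : Qual} (h : HasType ((T, d) :: Γ) St ψ.withVar t U q ε) (hΓ : WfEnv Γ St φ)
    (hψ : ψ ⊆ φ) (hv : v.IsAnswer) (hvT : HasType Γ St φ v T p ∅)
    (hsat : sat Γ St p ⊆ (p : Set Atom)) (hd : p ∩ ψ ⊆ d) :
    HasType Γ St φ (Tm.inst v t) (U.subst (QSubst.single p)) (Qual.inst p q) (Qual.inst p ε) := by
  have hp := hvT.subset_obs.1
  rw [Qual.inst_eq_subst, Qual.inst_eq_subst]
  refine h.subst (.answers St)
    { source := hΓ.store
      extends_store := fun _ _ h => h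
      compat := .single hΓ.store (hp.trans hΓ.obs) hsat hd
      typed := fun hi => ?_
      subst_obs := ?_
      target := hΓ }
  · cases hi with
    | zero =>
      rw [Ty.subst_single_shift]
      exact ⟨hv, hvT.of_isAnswer hv subset_rfl⟩
    | succ _ hi =>
      rw [Ty.subst_single_shift]
      exact ⟨.inr ⟨_, rfl⟩, hi.hasType_var subset_rfl⟩
  · rw [← Qual.inst_eq_subst]
    exact Qual.inst_subset hp (Qual.withVar_mono hψ)

theorem lam_inst {ε₀ : Qual} (h : HasType Γ St φ (.lam t) (.arr T d ε U r) q ε₀)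
    (hΓ : WfEnv Γ St φ) (hv : v.IsAnswer) (hvT : HasType Γ St φ v T p ∅)
    (hsat : sat Γ St p ⊆ (p : Set Atom)) (hd : p ∩ q ⊆ d) (hε : ε ⊆ φ.withVar)
    (hr : r ⊆ φ.withVar) :
    HasType Γ St φ (Tm.inst v t) (U.subst (QSubst.single p)) (Qual.inst p r) (Qual.inst p ε) := by
  generalize hu : Tm.lam t = u, hA : Ty.arr T d ε U r = A at h
  induction h generalizing T d ε U r with
  | abs _ _ hb hq =>
    cases hu
    cases hA
    exact hb.inst hΓ hq hv hvT hsat hd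
  | sub h₁ hs _ _ ih =>
    subst hA
    obtain ⟨hsub, hqs, -⟩ := hs
    cases hsub with
    | arr hdom hdq hcod hcodq heff =>
      have hp := hvT.subset_obs.1
      have hθ := QSubst.scoped_single (n := _) (D := _) (hp.trans hΓ.obs)
      have hvT' := hvT.sub ⟨hdom, ⟨subset_rfl, hp.trans hΓ.obs⟩, ⟨subset_rfl,
        Finset.empty_subset _⟩⟩ hp (Finset.empty_subset _)
      have hbody := ih hΓ hvT' hsat
        ((Finset.inter_subset_inter_left hqs.1).trans (hd.trans hdq.1))
        (heff.1.trans hε) (hcodq.1.trans hr) hu rfl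
      have hcodq' := hcodq.subst hθ
      have heff' := heff.subst hθ
      rw [← Qual.inst_eq_subst, ← Qual.inst_eq_subst] at hcodq' heff'
      exact hbody.sub ⟨hcod.subst hθ, hcodq', heff'⟩ (Qual.inst_subset hp hr)
        (Qual.inst_subset hp hε)
  | _ => cases hu

end HasType

/-! ### Inversion of typing -/

/-- A property of judgments `T^q ε` in the context `[Γ | Σ]^φ` that is stable under the
subsumption rule. It is the kind of property that can be proved by inversion of typing. -/
def SubsumptionClosed (Γ : Ctx S) (St : StoreTy S) (φ : Qual)
    (P : Ty S → Qual → Qual → Prop) : Prop :=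
  ∀ ⦃T U : Ty S⦄ ⦃p q ε₁ ε₂ : Qual⦄, P T p ε₁ → SubQ Γ St T p ε₁ U q ε₂ → q ⊆ φ → ε₂ ⊆ φ → P U q ε₂

theorem HasType.subsumptionClosed (Γ : Ctx S) (St : StoreTy S) (φ : Qual) (t : Tm S) :
    SubsumptionClosed Γ St φ (HasType Γ St φ t) := fun _ _ _ _ _ _ => .sub

namespace SubsumptionClosed

variable {Γ : Ctx S} {St : StoreTy S} {φ : Qual} {P : Ty S → Qual → Qual → Prop} {t t₁ t₂ : Tm S}
  {T : Ty S} {q ε : Qual}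

theorem app (hP : SubsumptionClosed Γ St φ P) (h : HasType Γ St φ (.app t₁ t₂) T q ε)
    (happ : ∀ {T U : Ty S} {p q r d ε₁ ε₂ ε₃ : Qual},
      HasType Γ St φ t₁ (.arr T d ε₃ U.shift r) q ε₁ → HasType Γ St φ t₂ T p ε₂ →
      (d : Set Atom) = sat Γ St p ∩ sat Γ St q → ε₃ ⊆ q.withVar →
      r ⊆ φ.withVar → P U (Qual.inst p r) (ε₁ ∪ ε₂ ∪ Qual.inst p ε₃)) : P T q ε := by
  generalize hu : Tm.app t₁ t₂ = u at h
  induction h with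
  | app ht₁ ht₂ hd _ _ hε hr => cases hu; exact happ ht₁ ht₂ hd hε hr
  | sub _ hs hq hε ih => exact hP (ih hP happ hu) hs hq hε
  | _ => cases hu

theorem letin (hP : SubsumptionClosed Γ St φ P) (h : HasType Γ St φ (.letin t₁ t₂) T q ε)
    (hlet : ∀ {T U : Ty S} {p q d ε₁ ε₂ : Qual}, HasType Γ St φ t₁ T p ε₁ →
      (d : Set Atom) = sat Γ St p →
      HasType ((T, d) :: Γ) St φ.withVar t₂ U.shift q ε₂ →
      P U (Qual.inst p q) (ε₁ ∪ Qual.inst p ε₂)) : P T q ε := by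
  generalize hu : Tm.letin t₁ t₂ = u at h
  induction h with
  | letin ht₁ hd ht₂ => cases hu; exact hlet ht₁ (hd.trans ht₁.sat_inter_sat_obs) ht₂
  | sub _ hs hq hε ih => exact hP (ih hP hlet hu) hs hq hε
  | _ => cases hu

theorem ref (hP : SubsumptionClosed Γ St φ P) (h : HasType Γ St φ (.ref t₁ t₂) T q ε)
    (href : ∀ {B : S.Base} {q ε₁ ε₂ : Qual}, HasType Γ St φ t₁ (.base S.allocTy) q ε₁ →
      HasType Γ St φ t₂ (.base B) ∅ ε₂ → P (.ref B) ∅ (ε₁ ∪ ε₂ ∪ q)) : P T q ε := by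
  generalize hu : Tm.ref t₁ t₂ = u at h
  induction h with
  | ref ht₁ ht₂ => cases hu; exact href ht₁ ht₂
  | sub _ hs hq hε ih => exact hP (ih hP href hu) hs hq hε
  | _ => cases hu

theorem deref (hP : SubsumptionClosed Γ St φ P) (h : HasType Γ St φ (.deref t) T q ε)
    (hderef : ∀ {B : S.Base} {q ε : Qual}, HasType Γ St φ t (.ref B) q ε →
      P (.base B) ∅ (ε ∪ q)) : P T q ε := by
  generalize hu : Tm.deref t = u at h
  induction h with
  | deref ht => cases hu; exact hderef ht
  | sub _ hs hq hε ih => exact hP (ih hP hderef hu) hs hq hε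
  | _ => cases hu

theorem assign (hP : SubsumptionClosed Γ St φ P) (h : HasType Γ St φ (.assign t₁ t₂) T q ε)
    (hassign : ∀ {B : S.Base} {q ε₁ ε₂ : Qual}, HasType Γ St φ t₁ (.ref B) q ε₁ →
      HasType Γ St φ t₂ (.base B) ∅ ε₂ → P (.base S.unitTy) ∅ (ε₁ ∪ ε₂ ∪ q)) : P T q ε := by
  generalize hu : Tm.assign t₁ t₂ = u at h
  induction h with
  | assign ht₁ ht₂ => cases hu; exact hassign ht₁ ht₂
  | sub _ hs hq hε ih => exact hP (ih hP hassign hu) hs hq hε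
  | _ => cases hu

end SubsumptionClosed

/-! ### Reduction of applications and let bindings -/

theorem StoreTy.Flat.eq_inter {St : StoreTy S} (h : St.Flat) {d p q : Qual}
    (hd : (d : Set Atom) = sat [] St p ∩ sat [] St q) : d = p ∩ q := by
  rwa [h.sat_nil, h.sat_nil, ← Finset.coe_inter, Finset.coe_inj] at hd

theorem StoreTy.Flat.eq_of_eq_sat {St : StoreTy S} (h : St.Flat) {d p : Qual}
    (hd : (d : Set Atom) = sat [] St p) : d = p := by
  rwa [h.sat_nil, Finset.coe_inj] at hd

namespace HasType

variable {St : StoreTy S} {t v : Tm S} {T : Ty S} {q ε : Qual}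

theorem app_lam (h : HasType [] St St.obs (.app (.lam t) v) T q ε) (hSt : St.Flat)
    (hv : v.IsValue) : HasType [] St St.obs (Tm.inst v t) T q ε := by
  refine (subsumptionClosed _ _ _ _).app h fun {T U p q r d ε₁ ε₂ ε₃} ht₁ ht₂ hd hε hr => ?_
  have hΓ := hSt.wellScoped.wfEnv
  have ⟨hq, hε₁⟩ := ht₁.subset_obs
  have ⟨hp, hε₂⟩ := ht₂.subset_obs
  have hε₃ := hε.trans (Qual.withVar_mono hq)
  have hbody := ht₁.lam_inst hΓ (.inl hv) (ht₂.of_isAnswer (.inl hv) hp) (hSt.sat_nil p).subset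
    (hSt.eq_inter hd).ge hε₃ hr
  rw [Ty.subst_single_shift] at hbody
  exact hbody.weaken_qual hΓ subset_rfl (Qual.inst_subset hp hr) Finset.subset_union_right
    (Finset.union_subset (Finset.union_subset hε₁ hε₂) (Qual.inst_subset hp hε₃))

theorem letin_value (h : HasType [] St St.obs (.letin v t) T q ε) (hSt : St.Flat)
    (hv : v.IsValue) : HasType [] St St.obs (Tm.inst v t) T q ε := by
  refine (subsumptionClosed _ _ _ _).letin h fun {T U p q d ε₁ ε₂} ht₁ hd ht₂ => ?_
  have hΓ := hSt.wellScoped.wfEnv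
  have ⟨hp, hε₁⟩ := ht₁.subset_obs
  have ⟨hq, hε₂⟩ := ht₂.subset_obs
  have hbody := ht₂.inst hΓ subset_rfl (.inl hv) (ht₁.of_isAnswer (.inl hv) hp)
    (hSt.sat_nil p).subset (Finset.inter_subset_left.trans (hSt.eq_of_eq_sat hd).ge)
  rw [Ty.subst_single_shift] at hbody
  exact hbody.weaken_qual hΓ subset_rfl (Qual.inst_subset hp hq) Finset.subset_union_right
    (Finset.union_subset hε₁ (Qual.inst_subset hp hε₂))

end HasType

/-! ### Typing of stores -/

namespace HasType

variable {Γ : Ctx S} {St : StoreTy S} {φ q ε : Qual} {v : Tm S} {B : S.Base}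

theorem exists_cst_of_isValue (h : HasType Γ St φ v (.base B) ∅ ε) (hv : v.IsValue) :
    ∃ c, v = .cst c ∧ S.mem c B := by
  generalize hT : Ty.base B = T, hq : (∅ : Qual) = q at h
  induction h with
  | cst hc => cases hT; exact ⟨_, rfl, hc⟩
  | loc => exact absurd hq.symm (Finset.singleton_ne_empty _)
  | abs => cases hT
  | sub _ hs _ _ ih =>
    subst hT hq
    obtain ⟨hsub, hqs, -⟩ := hs
    cases hsub
    exact ih hv rfl (Finset.subset_empty.1 hqs.1).symm
  | _ => cases hv

theorem lookup_of_loc {l : Loc} (h : HasType Γ St φ (.loc l) (.ref B) q ε) :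
    ∃ r, St.lookup l = some (.ref B, r) := by
  generalize hu : Tm.loc l = u, hT : Ty.ref B = T at h
  induction h with
  | loc hl => cases hu; subst hT; exact ⟨_, hl⟩
  | sub _ hs _ _ ih =>
    subst hT
    obtain ⟨hsub, -⟩ := hs
    cases hsub
    exact ih hu rfl
  | _ => cases hu

end HasType

namespace StoreTy

variable {St : StoreTy S} {l k : Loc} {b : Ty S × Qual}

@[simp] theorem aloc_mem_obs : aloc l ∈ St.obs ↔ l ∈ St.dom := by
  rw [St.obs_eq_domAtoms, aloc_mem_domAtoms]

theorem mem_dom_insert : k ∈ StoreTy.dom (St.insert l b) ↔ k = l ∨ k ∈ St.dom := by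
  simp only [dom, Finmap.mem_keys, Finmap.mem_insert]

theorem extends_insert (hl : l ∉ St.dom) : StoreTy.Extends (St.insert l b) St := by
  intro k c hk
  rwa [Finmap.lookup_insert_of_ne]
  rintro rfl
  exact hl (mem_dom.2 ⟨c, hk⟩)

theorem Flat.insert_ref (h : St.Flat) (B : S.Base) :
    StoreTy.Flat (St.insert l (Ty.ref B, ∅)) := by
  intro k T q hk
  obtain rfl | hkl := eq_or_ne k l
  · rw [Finmap.lookup_insert, Option.some_inj] at hk
    cases hk
    exact ⟨rfl, .inr ⟨B, rfl⟩⟩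
  · rw [Finmap.lookup_insert_of_ne _ hkl] at hk
    exact h _ _ _ hk

theorem flat_empty : (∅ : StoreTy S).Flat := fun l _ _ hl => by
  rw [Finmap.lookup_empty] at hl
  cases hl

theorem flat_singleton_base (w : Loc) (B : S.Base) :
    StoreTy.Flat (Finmap.singleton w (Ty.base B, (∅ : Qual))) := by
  intro l T q hl
  obtain rfl : l = w := by
    rw [← Finmap.mem_singleton, ← Finmap.mem_keys]
    exact mem_dom.2 ⟨_, hl⟩
  rw [Finmap.lookup_singleton_eq, Option.some_inj] at hl
  cases hl
  exact ⟨rfl, .inl ⟨B, rfl⟩⟩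

end StoreTy

/-- The store `σ` is described by the first-order store typing `St`, and its cells hold constants.
Unlike `WfStore`, which follows the order of allocation, this is evidently stable under
assignment. -/
structure Consistent (St : StoreTy S) (σ : Store S) : Prop where
  flat : St.Flat
  dom : ∀ l, l ∈ σ.dom ↔ l ∈ St.dom
  cell : ∀ l v, (l, Entry.cell v) ∈ σ →
    ∃ B c, St.lookup l = some (.ref B, ∅) ∧ v = .cst c ∧ S.mem c B

namespace Consistent

variable {St : StoreTy S} {σ σ₁ σ₂ : Store S} {l : Loc} {v : Tm S} {B : S.Base} {c : S.Const}
  {q ε : Qual}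

theorem alloc (h : Consistent St σ) (hl : l ∉ St.dom) (hc : S.mem c B) :
    Consistent (St.insert l (Ty.ref B, ∅)) (σ ++ [(l, .cell (.cst c))]) where
  flat := h.flat.insert_ref B
  dom k := by
    rw [StoreTy.mem_dom_insert, ← h.dom]
    simp [Store.dom, or_comm]
  cell k v hk := by
    rcases List.mem_append.1 hk with hk | hk
    · obtain ⟨B', c', hlk, hv⟩ := h.cell k v hk
      exact ⟨B', c', StoreTy.extends_insert hl _ _ hlk, hv⟩
    · cases List.mem_singleton.1 hk
      exact ⟨B, c, Finmap.lookup_insert _, rfl, hc⟩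

theorem update (h : Consistent St (σ₁ ++ (l, .cell v) :: σ₂))
    (hl : St.lookup l = some (.ref B, ∅)) (hc : S.mem c B) :
    Consistent St (σ₁ ++ (l, .cell (.cst c)) :: σ₂) where
  flat := h.flat
  dom k := by
    rw [← h.dom]
    simp [Store.dom]
  cell k w hk := by
    simp only [List.mem_append, List.mem_cons, Prod.mk.injEq, Entry.cell.injEq] at hk
    rcases hk with hk | ⟨rfl, rfl⟩ | hk
    · exact h.cell k w (by simp [hk])
    · exact ⟨B, c, hl, rfl, hc⟩
    · exact h.cell k w (by simp [hk])

theorem cell_of_loc (h : Consistent St (σ₁ ++ (l, .cell v) :: σ₂))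
    (ht : HasType [] St St.obs (.loc l) (.ref B) q ε) :
    St.lookup l = some (.ref B, ∅) ∧ ∃ c, v = .cst c ∧ S.mem c B := by
  obtain ⟨C, c, hl, hv, hc⟩ := h.cell l v (by simp)
  obtain ⟨r, hr⟩ := ht.lookup_of_loc
  rw [hl, Option.some_inj] at hr
  cases hr
  exact ⟨hl, c, hv, hc⟩

end Consistent

theorem WfStore.consistent {Γ : Ctx S} {φ : Qual} {St : StoreTy S} {σ : Store S}
    (h : WfStore Γ φ St σ) : Consistent St σ := by
  induction h with
  | empty => exact ⟨StoreTy.flat_empty, fun l => by simp [Store.dom, StoreTy.dom], nofun⟩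
  | init w =>
    refine ⟨StoreTy.flat_singleton_base w _, fun l => ?_, fun l v hl => by simp at hl⟩
    rw [StoreTy.dom, Finmap.mem_keys, Finmap.mem_singleton]
    simp [Store.dom]
  | alloc _ hval hv hl ih =>
    obtain ⟨c, rfl, hc⟩ := hv.exists_cst_of_isValue hval
    exact ih.alloc hl hc

/-! ### Growth of the store -/

/-- The store typing `St'` extends `St`, and among the new locations are those in `F`, which have
reference types. The qualifiers and effects of a running program grow by such sets `F`. -/
structure Grows (St St' : StoreTy S) (F : Qual) : Prop where
  flat : St.Flat
  flat' : St'.Flat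
  ext : St'.Extends St
  subset : F ⊆ St'.obs
  disj : Disjoint F St.obs
  ref : ∀ l, aloc l ∈ F → ∃ C r, St'.lookup l = some (.ref C, r)

namespace Grows

variable {St St' : StoreTy S} {F p q ε : Qual} {t : Tm S} {T : Ty S} {B : S.Base}

theorem refl (h : St.Flat) : Grows St St ∅ :=
  ⟨h, h, fun _ _ hl => hl, Finset.empty_subset _, Finset.disjoint_empty_left _,
    fun _ hl => absurd hl (Finset.notMem_empty _)⟩

theorem insert_ref (h : St.Flat) {l : Loc} (hl : l ∉ St.dom) (B : S.Base) :
    Grows St (St.insert l (Ty.ref B, ∅)) {aloc l} where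
  flat := h
  flat' := h.insert_ref B
  ext := StoreTy.extends_insert hl
  subset := Finset.singleton_subset_iff.2
    (StoreTy.aloc_mem_obs.2 (StoreTy.mem_dom_insert.2 (.inl rfl)))
  disj := Finset.disjoint_singleton_left.2 (mt StoreTy.aloc_mem_obs.1 hl)
  ref k hk := by
    cases Finset.mem_singleton.1 hk
    exact ⟨B, ∅, Finmap.lookup_insert _⟩

variable (hG : Grows St St' F)

include hG

theorem wfEnv : WfEnv [] St' St'.obs := hG.flat'.wellScoped.wfEnv

theorem weaken (h : HasType [] St St.obs t T q ε) : HasType [] St' St'.obs t T q ε :=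
  h.weaken_store hG.flat.wellScoped hG.flat' hG.ext hG.wfEnv hG.ext.obs_subset

theorem subset_obs (hq : q ⊆ St.obs) : q ∪ F ⊆ St'.obs :=
  Finset.union_subset (hq.trans hG.ext.obs_subset) hG.subset

theorem inter_union (hp : p ⊆ St.obs) : p ∩ (q ∪ F) = p ∩ q := by
  rw [Finset.inter_union_distrib_left,
    Finset.disjoint_iff_inter_eq_empty.1 (hG.disj.symm.mono_left hp), Finset.union_empty]

theorem restrict_base (h : HasType [] St' St'.obs t (.base B) (∅ ∪ F) ε) :
    HasType [] St' St'.obs t (.base B) ∅ ε := by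
  rw [Finset.empty_union] at h
  exact h.restrict_base hG.flat' (Finset.empty_subset _) fun l hl _ => hG.ref l hl

end Grows

/-! ### Growth below a binder -/

/-- The substitution that adds `F` to every qualifier that contains the innermost variable. -/
def QSubst.grow (F : Qual) : QSubst
  | 0 => F.withVar
  | i + 1 => {avar (i + 1)}

namespace Qual

variable {F p q : Qual} {a c : Atom}

theorem mem_substAtom_grow :
    c ∈ substAtom (QSubst.grow F) a ↔ c = a ∨ a = avar 0 ∧ c ∈ F.shift := by
  rcases a with (_ | i) | l <;> simp [QSubst.grow, withVar, eq_comm]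

theorem inst_union_subset : inst (p ∪ F) q ⊆ inst p q ∪ F := by
  intro a
  simp only [mem_inst, Finset.mem_union]
  tauto

theorem inst_subst_grow_subset : inst (p ∪ F) (q.subst (QSubst.grow F)) ⊆ inst p q ∪ F := by
  intro a
  simp only [mem_inst, mem_subst, mem_substAtom_grow, shiftAtom_mem_shift, Finset.mem_union]
  rintro (⟨hap, b, hb, rfl | ⟨rfl, -⟩⟩ | ⟨b, hb, rfl | ⟨-, haF⟩⟩) <;> tauto

end Qual

theorem Ty.subst_grow_shift (F : Qual) (T : Ty S) : T.shift.subst (QSubst.grow F) = T.shift := by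
  rw [Ty.subst_shift, Ty.shift_eq_subst]
  rfl

namespace Grows

variable {St St' : StoreTy S} {F d q ε : Qual} {t : Tm S} {T U : Ty S} (hG : Grows St St' F)

include hG

theorem compat_grow :
    Compat [(T, d)] St St.obs.withVar [(T, d ∪ F)] St' (QSubst.grow F) where
  dom :=
    { var := by
        rintro (_ | i) hi
        · exact withVar_subset_domAtoms (hG.subset.trans hG.wfEnv.obs)
        · exact Finset.singleton_subset_iff.2 (avar_mem_domAtoms.2 hi)
      loc := hG.ext.dom_subset }
  reach a a' b' ha' hr := by
    rcases Qual.atom_cases a' with rfl | ⟨a', rfl⟩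
    · obtain rfl : avar 0 = a :=
        (Qual.mem_substAtom_grow.1 ha').resolve_right fun h => Qual.zero_notMem_shift h.2
      rw [Reach.zero_iff, Qual.shift, Qual.rename, Finset.image_union, Finset.mem_union] at hr
      rcases hr with hb | hb
      · exact ⟨b', .single (Reach.zero_iff.2 hb), Qual.mem_substAtom_grow.2 (.inl rfl)⟩
      · exact ⟨avar 0, .refl, Qual.mem_substAtom_grow.2 (.inr ⟨rfl, hb⟩)⟩
    · obtain ⟨_, -, hr'⟩ := hr.of_shift hG.flat'.wellScoped
      exact absurd hr' hG.flat'.not_reach_nil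
  overlap a ha b hb c hca hcb := by
    have hF : ∀ {e}, e ∈ F.shift → e ∉ St.obs.withVar := by
      intro e he he'
      obtain ⟨f, hf, rfl⟩ := Qual.mem_shift.1 he
      exact Finset.disjoint_left.1 hG.disj hf (Qual.shiftAtom_mem_withVar.1 he')
    rcases Qual.mem_substAtom_grow.1 hca with rfl | ⟨rfl, hcF⟩ <;>
      rcases Qual.mem_substAtom_grow.1 hcb with rfl | ⟨rfl, hcF'⟩
    · exact ⟨_, .refl, .refl, hca⟩
    · exact absurd ha (hF hcF')
    · exact absurd hb (hF hcF)
    · exact ⟨_, .refl, .refl, hca⟩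

theorem weaken_body (h : HasType [(T, d)] St St.obs.withVar t U q ε)
    (hd : d ⊆ St.obs) (hT : T.Scoped 0 St'.dom) :
    HasType [(T, d ∪ F)] St' St'.obs.withVar t (U.subst (QSubst.grow F))
      (q.subst (QSubst.grow F)) (ε.subst (QSubst.grow F)) := by
  have hΔ : WfEnv [(T, d ∪ F)] St' St'.obs.withVar :=
    hG.wfEnv.cons hT ((hG.subset_obs hd).trans hG.wfEnv.obs)
  rw [← t.subst_var]
  refine h.subst (.answers St')
    { source := hG.flat.wellScoped
      extends_store := hG.ext
      compat := hG.compat_grow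
      typed := fun hi => ⟨.inr ⟨_, rfl⟩, ?_⟩
      subst_obs := fun c hc => ?_
      target := hΔ }
  · cases hi with
    | zero =>
      rw [Ty.subst_grow_shift]
      refine (HasType.var (.zero ..) Qual.zero_mem_withVar).weaken_qual
        (hΔ.mono (Qual.withVar_mono hG.subset)) ?_ subset_rfl subset_rfl (Finset.empty_subset _)
      exact Finset.singleton_subset_iff.2 Qual.zero_mem_withVar
    | succ _ hi => cases hi
  · obtain ⟨b, hb, hcb⟩ := Qual.mem_subst.1 hc
    rcases Qual.mem_substAtom_grow.1 hcb with rfl | ⟨-, hcF⟩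
    · exact Qual.withVar_mono hG.ext.obs_subset hb
    · exact Qual.withVar_mono hG.subset (Finset.mem_insert_of_mem hcF)

end Grows

/-! ### Evaluation contexts -/

theorem HasType.app_of_flat {St : StoreTy S} {t₁ t₂ : Tm S} {T U : Ty S}
    {p q r d ε₁ ε₂ ε₃ : Qual} (hSt : St.Flat)
    (ht₁ : HasType [] St St.obs t₁ (.arr T d ε₃ U.shift r) q ε₁)
    (ht₂ : HasType [] St St.obs t₂ T p ε₂) (hd : p ∩ q ⊆ d) (hε : ε₃ ⊆ q.withVar)
    (hr : r ⊆ St.obs.withVar) :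
    HasType [] St St.obs (.app t₁ t₂) U (Qual.inst p r) (ε₁ ∪ ε₂ ∪ Qual.inst p ε₃) := by
  refine app_of_subset hSt.wellScoped.wfEnv ht₁ ht₂ ?_ ?_ ?_ hε hr <;> simp only [hSt.sat_nil]
  · exact_mod_cast hd
  · exact_mod_cast ht₂.subset_obs.1
  · exact_mod_cast ht₁.subset_obs.1

theorem HasType.letin_of_flat {St : StoreTy S} {t₁ t₂ : Tm S} {T U : Ty S} {p q ε₁ ε₂ : Qual}
    (hSt : St.Flat) (ht₁ : HasType [] St St.obs t₁ T p ε₁)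
    (ht₂ : HasType [(T, p)] St St.obs.withVar t₂ U.shift q ε₂) :
    HasType [] St St.obs (.letin t₁ t₂) U (Qual.inst p q) (ε₁ ∪ Qual.inst p ε₂) :=
  ht₁.letin_of_eq_sat (hSt.sat_nil p).symm ht₂

namespace Grows

variable {St St' : StoreTy S} {F p q r d ε ε₁ ε₂ ε₃ : Qual} {t t' t₁ t₁' t₂ t₂' : Tm S}
  {T U : Ty S} {B : S.Base} (hG : Grows St St' F)

include hG

theorem widen {q' ε' : Qual} (h : HasType [] St' St'.obs t T q' ε')
    (hobs : q ⊆ St.obs ∧ ε ⊆ St.obs) (hq : q' ⊆ q ∪ F) (hε : ε' ⊆ ε ∪ F) :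
    HasType [] St' St'.obs t T (q ∪ F) (ε ∪ F) :=
  h.weaken_qual hG.wfEnv hq (hG.subset_obs hobs.1) hε (hG.subset_obs hobs.2)

theorem app_left (ht₁ : HasType [] St St.obs t₁ (.arr T d ε₃ U.shift r) q ε₁)
    (ht₁' : HasType [] St' St'.obs t₁' (.arr T d ε₃ U.shift r) (q ∪ F) (ε₁ ∪ F))
    (ht₂ : HasType [] St St.obs t₂ T p ε₂) (hd : p ∩ q ⊆ d) (hε : ε₃ ⊆ q.withVar)
    (hr : r ⊆ St.obs.withVar) :
    HasType [] St' St'.obs (.app t₁' t₂) U (Qual.inst p r ∪ F)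
      (ε₁ ∪ ε₂ ∪ Qual.inst p ε₃ ∪ F) := by
  have h := ht₁'.app_of_flat hG.flat' (hG.weaken ht₂)
    ((hG.inter_union ht₂.subset_obs.1).subset.trans hd)
    (hε.trans (Qual.withVar_mono Finset.subset_union_left))
    (hr.trans (Qual.withVar_mono hG.ext.obs_subset))
  exact hG.widen h (ht₁.app_of_flat hG.flat ht₂ hd hε hr).subset_obs Finset.subset_union_left
    (by grind)

theorem app_right (ht₁ : HasType [] St St.obs t₁ (.arr T d ε₃ U.shift r) q ε₁)
    (ht₂ : HasType [] St St.obs t₂ T p ε₂) (ht₂' : HasType [] St' St'.obs t₂' T (p ∪ F) (ε₂ ∪ F))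
    (hd : p ∩ q ⊆ d) (hε : ε₃ ⊆ q.withVar) (hr : r ⊆ St.obs.withVar) :
    HasType [] St' St'.obs (.app t₁ t₂') U (Qual.inst p r ∪ F)
      (ε₁ ∪ ε₂ ∪ Qual.inst p ε₃ ∪ F) := by
  have hoverlap : (p ∪ F) ∩ q ⊆ d := by
    rw [Finset.inter_comm, hG.inter_union ht₁.subset_obs.1, Finset.inter_comm]
    exact hd
  have h := (hG.weaken ht₁).app_of_flat hG.flat' ht₂' hoverlap hε
    (hr.trans (Qual.withVar_mono hG.ext.obs_subset))
  have heff : Qual.inst (p ∪ F) ε₃ ⊆ Qual.inst p ε₃ ∪ F := Qual.inst_union_subset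
  exact hG.widen h (ht₁.app_of_flat hG.flat ht₂ hd hε hr).subset_obs Qual.inst_union_subset
    (by grind)

theorem letin_left (ht₁ : HasType [] St St.obs t₁ T p ε₁)
    (ht₁' : HasType [] St' St'.obs t₁' T (p ∪ F) (ε₁ ∪ F))
    (ht₂ : HasType [(T, p)] St St.obs.withVar t₂ U.shift q ε₂) :
    HasType [] St' St'.obs (.letin t₁' t₂) U (Qual.inst p q ∪ F)
      (ε₁ ∪ Qual.inst p ε₂ ∪ F) := by
  have hbody := hG.weaken_body ht₂ ht₁.subset_obs.1 (ht₁'.ty_scoped hG.wfEnv)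
  rw [Ty.subst_grow_shift] at hbody
  have heff : Qual.inst (p ∪ F) (ε₂.subst (QSubst.grow F)) ⊆ Qual.inst p ε₂ ∪ F :=
    Qual.inst_subst_grow_subset
  exact hG.widen (ht₁'.letin_of_flat hG.flat' hbody) (ht₁.letin_of_flat hG.flat ht₂).subset_obs
    Qual.inst_subst_grow_subset (by grind)

theorem ref_left (ht₁ : HasType [] St St.obs t₁ (.base S.allocTy) q ε₁)
    (ht₁' : HasType [] St' St'.obs t₁' (.base S.allocTy) (q ∪ F) (ε₁ ∪ F))
    (ht₂ : HasType [] St St.obs t₂ (.base B) ∅ ε₂) :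
    HasType [] St' St'.obs (.ref t₁' t₂) (.ref B) (∅ ∪ F) (ε₁ ∪ ε₂ ∪ q ∪ F) :=
  hG.widen (.ref ht₁' (hG.weaken ht₂)) (HasType.ref ht₁ ht₂).subset_obs
    (Finset.empty_subset _) (by grind)

theorem ref_right (ht₁ : HasType [] St St.obs t₁ (.base S.allocTy) q ε₁)
    (ht₂ : HasType [] St St.obs t₂ (.base B) ∅ ε₂)
    (ht₂' : HasType [] St' St'.obs t₂' (.base B) (∅ ∪ F) (ε₂ ∪ F)) :
    HasType [] St' St'.obs (.ref t₁ t₂') (.ref B) (∅ ∪ F) (ε₁ ∪ ε₂ ∪ q ∪ F) :=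
  hG.widen (.ref (hG.weaken ht₁) (hG.restrict_base ht₂')) (HasType.ref ht₁ ht₂).subset_obs
    (Finset.empty_subset _) (by grind)

theorem deref (ht : HasType [] St St.obs t (.ref B) q ε)
    (ht' : HasType [] St' St'.obs t' (.ref B) (q ∪ F) (ε ∪ F)) :
    HasType [] St' St'.obs (.deref t') (.base B) (∅ ∪ F) (ε ∪ q ∪ F) :=
  hG.widen (.deref ht') (HasType.deref ht).subset_obs (Finset.empty_subset _) (by grind)

theorem assign_left (ht₁ : HasType [] St St.obs t₁ (.ref B) q ε₁)
    (ht₁' : HasType [] St' St'.obs t₁' (.ref B) (q ∪ F) (ε₁ ∪ F))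
    (ht₂ : HasType [] St St.obs t₂ (.base B) ∅ ε₂) :
    HasType [] St' St'.obs (.assign t₁' t₂) (.base S.unitTy) (∅ ∪ F) (ε₁ ∪ ε₂ ∪ q ∪ F) :=
  hG.widen (.assign ht₁' (hG.weaken ht₂)) (HasType.assign ht₁ ht₂).subset_obs
    (Finset.empty_subset _) (by grind)

theorem assign_right (ht₁ : HasType [] St St.obs t₁ (.ref B) q ε₁)
    (ht₂ : HasType [] St St.obs t₂ (.base B) ∅ ε₂)
    (ht₂' : HasType [] St' St'.obs t₂' (.base B) (∅ ∪ F) (ε₂ ∪ F)) :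
    HasType [] St' St'.obs (.assign t₁ t₂') (.base S.unitTy) (∅ ∪ F) (ε₁ ∪ ε₂ ∪ q ∪ F) :=
  hG.widen (.assign (hG.weaken ht₁) (hG.restrict_base ht₂')) (HasType.assign ht₁ ht₂).subset_obs
    (Finset.empty_subset _) (by grind)

theorem subQ (hs : SubQ [] St T p ε₁ U q ε₂) (hobs : q ⊆ St.obs ∧ ε₂ ⊆ St.obs)
    (ht : HasType [] St' St'.obs t T (p ∪ F) (ε₁ ∪ F)) :
    HasType [] St' St'.obs t U (q ∪ F) (ε₂ ∪ F) := by
  have hsub := hs.1.subst (Δ := []) (St' := St')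
    (QSubst.scoped_ofRen (ρ := id) (fun _ hi => hi) hG.ext.dom_subset)
  rw [Ty.subst_ofRen_id, Ty.subst_ofRen_id] at hsub
  have hq := hG.subset_obs hobs.1
  have hε := hG.subset_obs hobs.2
  exact ht.sub ⟨hsub, ⟨Finset.union_subset_union_left hs.2.1.1, hq.trans hG.wfEnv.obs⟩,
    ⟨Finset.union_subset_union_left hs.2.2.1, hε.trans hG.wfEnv.obs⟩⟩ hq hε

end Grows

/-- The closed term `u` in the hole of `E` is typable, and when it is replaced by a term of the same
type whose qualifier and effect have grown by new locations `F`, then `E[u]`, of type `T`,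
qualifier `q` and effect `ε`, grows by `F` as well. -/
def Replaceable (St : StoreTy S) (E : ECtx S) (u : Tm S) (T : Ty S) (q ε : Qual) : Prop :=
  ∃ Tu qu εu, HasType [] St St.obs u Tu qu εu ∧ ∀ {St' F u'}, Grows St St' F →
    HasType [] St' St'.obs u' Tu (qu ∪ F) (εu ∪ F) →
    HasType [] St' St'.obs (E.plug u') T (q ∪ F) (ε ∪ F)

theorem Replaceable.frame {St : StoreTy S} {E E' : ECtx S} {u : Tm S} {T T' : Ty S}
    {q q' ε ε' : Qual} (h : Replaceable St E u T q ε)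
    (hE : ∀ {St' F u'}, Grows St St' F → HasType [] St' St'.obs (E.plug u') T (q ∪ F) (ε ∪ F) →
      HasType [] St' St'.obs (E'.plug u') T' (q' ∪ F) (ε' ∪ F)) :
    Replaceable St E' u T' q' ε' := by
  obtain ⟨Tu, qu, εu, hu, hplug⟩ := h
  exact ⟨Tu, qu, εu, hu, fun hG hu' => hE hG (hplug hG hu')⟩

theorem Replaceable.subsumptionClosed (St : StoreTy S) (E : ECtx S) (u : Tm S) :
    SubsumptionClosed [] St St.obs (Replaceable St E u) :=
  fun _ _ _ _ _ _ h hs hq hε => h.frame fun hG h' => hG.subQ hs ⟨hq, hε⟩ h'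

theorem HasType.replaceable {St : StoreTy S} {E : ECtx S} {u : Tm S} {T : Ty S} {q ε : Qual}
    (h : HasType [] St St.obs (E.plug u) T q ε) (hSt : St.Flat) : Replaceable St E u T q ε := by
  have hclosed := Replaceable.subsumptionClosed St
  induction E generalizing T q ε with
  | hole => exact ⟨T, q, ε, h, fun _ h' => h'⟩
  | appL E t ih =>
    exact (hclosed _ _).app h fun ht₁ ht₂ hd hε hr => (ih ht₁).frame fun hG h' =>
      hG.app_left ht₁ h' ht₂ (hSt.eq_inter hd).ge hε hr
  | appR v hv E ih =>
    exact (hclosed _ _).app h fun ht₁ ht₂ hd hε hr => (ih ht₂).frame fun hG h' =>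
      hG.app_right ht₁ ht₂ h' (hSt.eq_inter hd).ge hε hr
  | refL E t ih =>
    exact (hclosed _ _).ref h fun ht₁ ht₂ => (ih ht₁).frame fun hG h' => hG.ref_left ht₁ h' ht₂
  | refR v hv E ih =>
    exact (hclosed _ _).ref h fun ht₁ ht₂ => (ih ht₂).frame fun hG h' => hG.ref_right ht₁ ht₂ h'
  | deref E ih =>
    exact (hclosed _ _).deref h fun ht => (ih ht).frame fun hG h' => hG.deref ht h'
  | assignL E t ih =>
    exact (hclosed _ _).assign h fun ht₁ ht₂ => (ih ht₁).frame fun hG h' =>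
      hG.assign_left ht₁ h' ht₂
  | assignR v hv E ih =>
    exact (hclosed _ _).assign h fun ht₁ ht₂ => (ih ht₂).frame fun hG h' =>
      hG.assign_right ht₁ ht₂ h'
  | letin E t ih =>
    refine (hclosed _ _).letin h fun ht₁ hd ht₂ => (ih ht₁).frame fun hG h' => ?_
    exact hG.letin_left ht₁ h' (hSt.eq_of_eq_sat hd ▸ ht₂)

theorem HasType.plug_replace {St : StoreTy S} {E : ECtx S} {u u' : Tm S} {T : Ty S} {q ε : Qual}
    (h : HasType [] St St.obs (E.plug u) T q ε) (hSt : St.Flat)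
    (hu : ∀ {Tu qu εu}, HasType [] St St.obs u Tu qu εu → HasType [] St St.obs u' Tu qu εu) :
    HasType [] St St.obs (E.plug u') T q ε := by
  obtain ⟨Tu, qu, εu, h₁, hplug⟩ := h.replaceable hSt
  simpa only [Finset.union_empty] using
    hplug (.refl hSt) (by simpa only [Finset.union_empty] using hu h₁)

/-! ### Preservation -/

theorem HasType.exists_cst_of_ref {St : StoreTy S} {Γ : Ctx S} {φ : Qual} {a v : Tm S} {T : Ty S}
    {q ε : Qual} (h : HasType Γ St φ (.ref a v) T q ε) (hv : v.IsValue) :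
    ∃ B c, T = .ref B ∧ v = .cst c ∧ S.mem c B := by
  refine SubsumptionClosed.ref (P := fun T _ _ => ∃ B c, T = .ref B ∧ v = .cst c ∧ S.mem c B)
    ?_ h fun _ hcell => ?_
  · rintro _ U _ _ _ _ ⟨B, c, rfl, hc⟩ ⟨hsub, -⟩ - -
    cases hsub
    exact ⟨B, c, rfl, hc⟩
  · obtain ⟨c, hc⟩ := hcell.exists_cst_of_isValue hv
    exact ⟨_, c, rfl, hc⟩

namespace Consistent

variable {St : StoreTy S} {σ₁ σ₂ : Store S} {l : Loc} {v v' : Tm S} {T : Ty S} {q ε : Qual}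

theorem hasType_of_deref (hσ : Consistent St (σ₁ ++ (l, .cell v) :: σ₂))
    (h : HasType [] St St.obs (.deref (.loc l)) T q ε) : HasType [] St St.obs v T q ε := by
  refine (HasType.subsumptionClosed _ _ _ _).deref h fun ht => ?_
  obtain ⟨-, c, rfl, hc⟩ := hσ.cell_of_loc ht
  exact (HasType.cst hc).weaken_qual hσ.flat.wellScoped.wfEnv subset_rfl (Finset.empty_subset _)
    (Finset.empty_subset _) ht.deref.subset_obs.2

theorem assign (hσ : Consistent St (σ₁ ++ (l, .cell v) :: σ₂))
    (h : HasType [] St St.obs (.assign (.loc l) v') T q ε) (hv' : v'.IsValue) :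
    Consistent St (σ₁ ++ (l, .cell v') :: σ₂) := by
  refine SubsumptionClosed.assign (P := fun _ _ _ => _) (fun _ _ _ _ _ _ hP _ _ _ => hP) h
    fun hloc hval => ?_
  obtain ⟨c, rfl, hc⟩ := hval.exists_cst_of_isValue hv'
  exact hσ.update (hσ.cell_of_loc hloc).1 hc

end Consistent

theorem HasType.unit_of_assign {St : StoreTy S} {t₁ t₂ : Tm S} {T : Ty S} {q ε : Qual}
    (hSt : St.Flat) (h : HasType [] St St.obs (.assign t₁ t₂) T q ε) :
    HasType [] St St.obs (.cst S.unit) T q ε :=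
  (HasType.subsumptionClosed _ _ _ _).assign h fun h₁ h₂ =>
    (HasType.cst S.unit_mem).weaken_qual hSt.wellScoped.wfEnv subset_rfl (Finset.empty_subset _)
      (Finset.empty_subset _) (h₁.assign h₂).subset_obs.2

theorem HasType.loc_insert_ref {St : StoreTy S} {l : Loc} {B : S.Base} {u : Tm S} {q ε : Qual}
    (hSt : St.Flat) (hl : l ∉ St.dom) (h : HasType [] St St.obs u (.ref B) q ε) :
    HasType [] (St.insert l (Ty.ref B, ∅)) (StoreTy.obs (St.insert l (Ty.ref B, ∅))) (.loc l)
      (.ref B) (q ∪ {aloc l}) (ε ∪ {aloc l}) :=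
  have hG := Grows.insert_ref hSt hl B
  hG.widen (.loc (Finmap.lookup_insert _) (Finset.singleton_subset_iff.1 hG.subset)) h.subset_obs
    Finset.subset_union_right (Finset.empty_subset _)

theorem Step.preservation {σ σ' : Store S} {t t' : Tm S} (hstep : Step σ t σ' t')
    {St : StoreTy S} (hσ : Consistent St σ) {T : Ty S} {q ε : Qual}
    (ht : HasType [] St St.obs t T q ε) :
    ∃ St' F, Grows St St' F ∧ Consistent St' σ' ∧
      HasType [] St' St'.obs t' T (q ∪ F) (ε ∪ F) := by
  have hSt := hσ.flat
  have of_same_typing {σ' t'} (hσ' : Consistent St σ') (ht' : HasType [] St St.obs t' T q ε) :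
      ∃ St' F, Grows St St' F ∧ Consistent St' σ' ∧
        HasType [] St' St'.obs t' T (q ∪ F) (ε ∪ F) :=
    ⟨St, ∅, .refl hSt, hσ', by simpa only [Finset.union_empty] using ht'⟩
  cases hstep with
  | beta _ E t v hv =>
    exact of_same_typing hσ (ht.plug_replace hSt fun h => h.app_lam hSt hv)
  | letin _ E v t hv =>
    exact of_same_typing hσ (ht.plug_replace hSt fun h => h.letin_value hSt hv)
  | ref _ E a v l _ hv hl =>
    obtain ⟨Tu, qu, εu, hu, hplug⟩ := ht.replaceable hSt
    obtain ⟨B, c, rfl, rfl, hc⟩ := hu.exists_cst_of_ref hv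
    have hl' : l ∉ St.dom := mt (hσ.dom l).2 hl
    have hG := Grows.insert_ref hSt hl' B
    exact ⟨_, _, hG, hσ.alloc hl' hc, hplug hG (HasType.loc_insert_ref hSt hl' hu)⟩
  | deref σ₁ σ₂ E l v =>
    exact of_same_typing hσ (ht.plug_replace hSt hσ.hasType_of_deref)
  | assign σ₁ σ₂ E l v v' hv' =>
    obtain ⟨_, _, _, hu, -⟩ := ht.replaceable hSt
    exact of_same_typing (hσ.assign hu hv') (ht.plug_replace hSt (HasType.unit_of_assign hSt))

end LambdaStar

/-- Preservation of separation: interleaved executions of two closed terms with disjoint qualifiers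
preserve types and disjointness. -/
theorem mainTheorem10 (S : LambdaStar.Sig) (St : LambdaStar.StoreTy S)
    (σ σ' σ'' : LambdaStar.Store S) (t₁ t₁' t₂ t₂' : LambdaStar.Tm S)
    (T₁ T₂ : LambdaStar.Ty S) (q₁ q₂ ε₁ ε₂ : LambdaStar.Qual)
    (ht₁ : LambdaStar.HasType [] St St.obs t₁ T₁ q₁ ε₁)
    (ht₂ : LambdaStar.HasType [] St St.obs t₂ T₂ q₂ ε₂)
    (hσ : LambdaStar.WfStore [] St.obs St σ)
    (hstep₁ : LambdaStar.Step σ t₁ σ' t₁')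
    (hstep₂ : LambdaStar.Step σ' t₂ σ'' t₂')
    (hq : q₁ ∩ q₂ ⊆ ∅) :
    ∃ (p₁ p₂ ε₁' ε₂' : LambdaStar.Qual) (St' St'' : LambdaStar.StoreTy S),
      St'.WellScoped ∧ St''.WellScoped ∧
      St'.Extends St ∧ St''.Extends St' ∧
      LambdaStar.HasType [] St' St'.obs t₁' T₁ p₁ ε₁' ∧
      LambdaStar.HasType [] St'' St''.obs t₂' T₂ p₂ ε₂' ∧
      p₁ ∩ p₂ ⊆ ∅ := by
  obtain ⟨St', F₁, hG₁, hσ₁, h₁⟩ := hstep₁.preservation hσ.consistent ht₁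
  obtain ⟨St'', F₂, hG₂, -, h₂⟩ := hstep₂.preservation hσ₁ (hG₁.weaken ht₂)
  refine ⟨_, _, _, _, St', St'', hG₁.flat'.wellScoped, hG₂.flat'.wellScoped, hG₁.ext, hG₂.ext,
    h₁, h₂, ?_⟩
  rw [hG₂.inter_union (hG₁.subset_obs ht₁.subset_obs.1), Finset.inter_comm,
    hG₁.inter_union ht₂.subset_obs.1, Finset.inter_comm]
  exact hq
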